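/- Let $d\ge 1$ be an integer, let $s\in(0,1)$ with $d>2s$, let $\gamma\in[0,2s)\cap[0,d-2s]$ and $\gamma_0\in[0,\gamma]$, and let $\rho$ be a measurable weight on $\mathbb{R}^d$ such that, for some constants $0<c<C$, $$c|x|^{-\gamma_0}\le\rho(x)\le C|x|^{-\gamma_0}\ \text{ for a.e. } |x|<1,\qquad c|x|^{-\gamma}\le\rho(x)\le C|x|^{-\gamma}\ \text{ for a.e. } |x|\ge 1 .$$ For $1\le q<\infty$ let $L^q_\rho(\mathbb{R}^d)$ be the $L^q$ space of real functions with respect to the measure $\rho(x)\,dx$. For $\phi\in C_c^\infty(\mathbb{R}^d)$ let $$(-\Delta)^s\phi(x)=C_{d,s}\,\mathrm{p.v.}\!\int_{\mathbb{R}^d}\frac{\phi(x)-\phi(y)}{|x-y|^{d+2s}}\,dy,\qquad C_{d,s}=\frac{s\,4^s\,\Gamma(d/2+s)}{\pi^{d/2}\,\Gamma(1-s)},$$ and for other functions $v$ understand $(-\Delta)^s v$ in the sense of distributions, i.e. $(-\Delta)^s v=f$ means $\int v\,(-\Delta)^s\phi\,dx=\int f\phi\,dx$ for all $\phi\in C_c^\infty(\mathbb{R}^d)$.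 Put $A(v)=\rho^{-1}(-\Delta)^s v$. Let $\dot H^s(\mathbb{R}^d)$ be the closure of $C_c^\infty(\mathbb{R}^d)$ with respect to the norm $\|\phi\|_{\dot H^s}^2=\frac{C_{d,s}}{2}\iint\frac{(\phi(x)-\phi(y))^2}{|x-y|^{d+2s}}\,dx\,dy$, regarded as a space of locally integrable functions (a locally integrable $v$ belongs to it if there are $\phi_n\in C_c^\infty(\mathbb{R}^d)$ with $\|v-\phi_n\|_{\dot H^s}\to0$ and $\phi_n\to v$ in $L^1_{\rm loc}(\mathbb{R}^d)$). Let $p\in\left[2,\frac{2(d-\gamma)}{d-2s}\right)$ and $p'=p/(p-1)$, and let $v,w\in L^p_\rho(\mathbb{R}^d)$ be such that $(-\Delta)^s v$ and $(-\Delta)^s w$ are functions with $A(v),A(w)\in L^{p'}_\rho(\mathbb{R}^d)$. Then $v,w\in\dot H^s(\mathbb{R}^d)$, the integrals below converge absolutely, and $$\int_{\mathbb{R}^d} v\,(-\Delta)^s w\,dx=\int_{\mathbb{R}^d}(-\Delta)^s v\;w\,dx=\frac{C_{d,s}}{2}\int_{\mathbb{R}^d}\int_{\mathbb{R}^d}\frac{(v(x)-v(y))(w(x)-w(y))}{|x-y|^{d+2s}}\,dx\,dy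 .$$ -/

import Mathlib

open MeasureTheory Filter Topology
open scoped ContDiff

noncomputable section

namespace WeightedFracLap

/-- `ℝ^d` with its Euclidean norm and Lebesgue measure. -/
abbrev Rd (d : ℕ) : Type := EuclideanSpace ℝ (Fin d)

/-- The normalizing constant of the fractional Laplacian,
`C_{d,s} = s 4^s Γ(d/2 + s) / (π^(d/2) Γ(1 - s))`, for `0 < s < 1`. -/
def fracConst (d : ℕ) (s : ℝ) : ℝ :=
  s * (4 : ℝ) ^ s * Real.Gamma ((d : ℝ) / 2 + s) /
    (Real.pi ^ ((d : ℝ) / 2) * Real.Gamma (1 - s))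

/-- Test functions: smooth functions with compact support. -/
def IsTest {d : ℕ} (φ : Rd d → ℝ) : Prop :=
  ContDiff ℝ ∞ φ ∧ HasCompactSupport φ

/-- The fractional Laplacian of a test function as a principal value:
`C_{d,s} lim_{ε → 0+} ∫_{|x - y| > ε} (φ x - φ y) / |x - y|^(d + 2s) dy`. -/
def fracLap {d : ℕ} (s : ℝ) (φ : Rd d → ℝ) (x : Rd d) : ℝ :=
  limUnder (𝓝[>] (0 : ℝ)) fun ε : ℝ =>
    fracConst d s *
      ∫ y in {y : Rd d | ε < ‖x - y‖}, (φ x - φ y) / ‖x - y‖ ^ ((d : ℝ) + 2 * s)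

/-- `(-Δ)^s v = f` in the sense of distributions.  It is used only for `v ∈ L^p_ρ` and
`ρ⁻¹ f ∈ L^{p'}_ρ`; then `v`, `f` are locally integrable and both integrals converge absolutely,
since `(-Δ)^s φ` is bounded and `O(|x|^(-d-2s))`. -/
def IsDistribFracLap {d : ℕ} (s : ℝ) (v f : Rd d → ℝ) : Prop :=
  ∀ φ : Rd d → ℝ, IsTest φ → ∫ x, v x * fracLap s φ x = ∫ x, f x * φ x

/-- The two-sided power bounds on the weight `ρ`, with exponent `γ₀` in the unit ball and `γ`
outside of it. -/
structure IsWeight {d : ℕ} (ρ : Rd d → ℝ) (γ₀ γ c C : ℝ) : Prop where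
  aemeasurable : AEMeasurable ρ volume
  c_pos : 0 < c
  c_lt_C : c < C
  inner : ∀ᵐ x : Rd d, ‖x‖ < 1 → c * ‖x‖ ^ (-γ₀) ≤ ρ x ∧ ρ x ≤ C * ‖x‖ ^ (-γ₀)
  outer : ∀ᵐ x : Rd d, 1 ≤ ‖x‖ → c * ‖x‖ ^ (-γ) ≤ ρ x ∧ ρ x ≤ C * ‖x‖ ^ (-γ)

/-- Membership in the weighted Lebesgue space `L^p_ρ`, that is `L^p` of the measure `ρ(x) dx`. -/
def MemLpWeight {d : ℕ} (p : ℝ) (ρ v : Rd d → ℝ) : Prop :=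
  MemLp v (ENNReal.ofReal p) (volume.withDensity fun x => ENNReal.ofReal (ρ x))

/-- The square of the `Ḣ^s` norm, with values in `[0, ∞]`. -/
def hdotNormSq {d : ℕ} (s : ℝ) (v : Rd d → ℝ) : ENNReal :=
  ENNReal.ofReal (fracConst d s / 2) *
    ∫⁻ x, ∫⁻ y, ENNReal.ofReal ((v x - v y) ^ 2 / ‖x - y‖ ^ ((d : ℝ) + 2 * s))

/-- `v ∈ Ḣ^s(ℝ^d)`, the closure of the test functions in the `Ḣ^s` norm.  The elements of the
closure are functions: the approximating sequence also converges to `v` in `L^1_loc`, which fixes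
the additive constant that the seminorm does not see. -/
def MemHdot {d : ℕ} (s : ℝ) (v : Rd d → ℝ) : Prop :=
  LocallyIntegrable v volume ∧
  ∃ φ : ℕ → Rd d → ℝ, (∀ n, IsTest (φ n)) ∧
    Tendsto (fun n => hdotNormSq s (fun x => v x - φ n x)) atTop (𝓝 0) ∧
    ∀ K : Set (Rd d), IsCompact K →
      Tendsto (fun n => ∫⁻ x in K, ‖v x - φ n x‖ₑ) atTop (𝓝 0)

/-- The integrand of the Gagliardo bilinear form. -/
def gagliardoIntegrand {d : ℕ} (s : ℝ) (v w : Rd d → ℝ) (x y : Rd d) : ℝ :=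
  (v x - v y) * (w x - w y) / ‖x - y‖ ^ ((d : ℝ) + 2 * s)

end WeightedFracLap

end

/-!
The weight is of class `A₁` (averages over small balls are controlled by the value at the center),
so mollification converges in `L^p_ρ`. Mollify `v` to `u` and cut off at scale `R` to get `φ = ψ u`.
The energy of `ψ u` differs from `∫ u (-Δ)^s (ψ² u)` only by a commutator, at most a multiple of
`∫ u² (R + |x|)^(-2s)`. Because `p` is subcritical, `L^p_ρ` embeds into `L²((1 + |x|)^(-2s) dx)`, so
this error vanishes as `R → ∞`; hence the energies of the approximants converge to `∫ f v` with
`f = (-Δ)^s v`. Fatou's lemma then bounds the energy of `v` by `∫ f v`, and pairing `v` with the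
approximants gives `∫ f v` again, so the approximants converge strongly in `Ḣ^s`. The bilinear
identity, which for test functions is the distributional equation, passes to the limit.
-/

noncomputable section

namespace WeightedFracLap

/-! ### Radial integrals -/

section Radial

variable {E : Type*} [NormedAddCommGroup E] [NormedSpace ℝ E] [FiniteDimensional ℝ E]
  [MeasurableSpace E] [BorelSpace E] {μ : Measure E} [μ.IsAddHaarMeasure]

open Module

theorem locallyIntegrable_norm_rpow_neg {a : ℝ} (ha : a < finrank ℝ E) :
    LocallyIntegrable (fun z : E => ‖z‖ ^ (-a)) μ := by
  rcases (finrank ℝ E).eq_zero_or_pos with h0 | hpos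
  · have := finrank_zero_iff.1 h0
    exact Continuous.locallyIntegrable continuous_of_discreteTopology
  · exact locallyIntegrable_of_norm_le_rpow (C := 1) hpos ha
      (.of_forall fun z => by rw [Real.norm_of_nonneg (by positivity), one_mul])
      (by fun_prop : Measurable fun z : E => ‖z‖ ^ (-a)).aestronglyMeasurable

theorem integrable_min_one_norm_sq_div_rpow {r : ℝ} (hr : (finrank ℝ E : ℝ) < r)
    (hr' : r < finrank ℝ E + 2) :
    Integrable (fun z : E => min 1 (‖z‖ ^ 2) / ‖z‖ ^ r) μ := by
  have hr0 : 0 < r := (Nat.cast_nonneg _).trans_lt hr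
  have hin : Integrable ((Metric.closedBall (0 : E) 1).indicator fun z => ‖z‖ ^ (-(r - 2))) μ :=
    ((locallyIntegrable_norm_rpow_neg (by linarith)).integrableOn_isCompact
      (isCompact_closedBall 0 1)).integrable_indicator Metric.isClosed_closedBall.measurableSet
  have hout : Integrable (fun z : E => 2 ^ r * (1 + ‖z‖) ^ (-r)) μ :=
    (integrable_one_add_norm hr).const_mul _
  have hm : Measurable fun z : E => min 1 (‖z‖ ^ 2) / ‖z‖ ^ r := by fun_prop
  refine (hin.add hout).mono' hm.aestronglyMeasurable (.of_forall fun z => ?_)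
  rw [Real.norm_of_nonneg (by positivity), Pi.add_apply]
  have hout0 : 0 ≤ 2 ^ r * (1 + ‖z‖) ^ (-r) := by positivity
  rcases le_or_gt ‖z‖ 1 with hz | hz
  · rw [Set.indicator_of_mem (by simpa using hz)]
    refine le_add_of_le_of_nonneg ?_ hout0
    rcases eq_or_ne z 0 with rfl | hz0
    · simp only [norm_zero, ne_eq, OfNat.ofNat_ne_zero, not_false_eq_true, zero_pow,
        zero_le_one, inf_of_le_right, zero_div]
      positivity
    · have hz' : 0 < ‖z‖ := norm_pos_iff.2 hz0
      rw [neg_sub, Real.rpow_sub hz', Real.rpow_two]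
      gcongr
      exact min_le_right _ _
  · rw [Set.indicator_of_notMem (by simpa using hz), zero_add, Real.rpow_neg (by positivity),
      ← div_eq_mul_inv, ← Real.div_rpow zero_le_two (by positivity), div_eq_mul_inv _ (‖z‖ ^ r),
      ← Real.inv_rpow (norm_nonneg z)]
    refine (mul_le_of_le_one_left (by positivity) (min_le_left _ _)).trans ?_
    gcongr
    rw [inv_eq_one_div, div_le_div_iff₀ (by linarith) (by positivity)]
    linarith

theorem integrable_div_norm_rpow {r M : ℝ} (hr : (finrank ℝ E : ℝ) < r)
    (hr' : r < finrank ℝ E + 2) {h : E → ℝ} (hm : AEStronglyMeasurable h μ)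
    (hle : ∀ z, |h z| ≤ M * min 1 (‖z‖ ^ 2)) :
    Integrable (fun z => h z / ‖z‖ ^ r) μ := by
  have hm' : Measurable fun z : E => ‖z‖ ^ r := by fun_prop
  refine ((integrable_min_one_norm_sq_div_rpow hr hr').const_mul M).mono'
    (hm.aemeasurable.div hm'.aemeasurable).aestronglyMeasurable (.of_forall fun z => ?_)
  rw [norm_div, Real.norm_eq_abs, Real.norm_of_nonneg (by positivity), mul_div_assoc']
  gcongr
  exact hle z

theorem integral_abs_div_norm_rpow_le {r M : ℝ} (hr : (finrank ℝ E : ℝ) < r)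
    (hr' : r < finrank ℝ E + 2) {h : E → ℝ} (hle : ∀ z, |h z| ≤ M * min 1 (‖z‖ ^ 2)) :
    ∫ z, |h z| / ‖z‖ ^ r ∂μ ≤ M * ∫ z, min 1 (‖z‖ ^ 2) / ‖z‖ ^ r ∂μ := by
  rw [← integral_const_mul]
  refine integral_mono_of_nonneg (.of_forall fun z => by positivity)
    ((integrable_min_one_norm_sq_div_rpow hr hr').const_mul M) (.of_forall fun z => ?_)
  simp only [mul_div_assoc']
  gcongr
  exact hle z

theorem integral_abs_div_norm_rpow_le_of_far {r R M : ℝ} (hr : 0 ≤ r) {h : E → ℝ} {x : E}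
    (hx0 : 0 < ‖x‖) (hx : 2 * R ≤ ‖x‖) (hle : ∀ z, |h z| ≤ M)
    (hsupp : ∀ z, R ≤ ‖x + z‖ → R ≤ ‖x - z‖ → h z = 0) :
    ∫ z, |h z| / ‖z‖ ^ r ∂μ ≤ 2 * μ.real (Metric.ball 0 R) * M * (‖x‖ / 2) ^ (-r) := by
  set S := Metric.ball (-x) R ∪ Metric.ball x R
  have hM : 0 ≤ M := (abs_nonneg _).trans (hle 0)
  have hfar : ∀ z ∈ S, ‖x‖ / 2 ≤ ‖z‖ := by
    rintro z (hz | hz) <;> rw [Metric.mem_ball, dist_eq_norm] at hz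
    · have := norm_sub_le (z - -x) z
      rw [sub_neg_eq_add, add_sub_cancel_left] at this
      rw [sub_neg_eq_add] at hz
      linarith
    · have := norm_sub_le z (z - x)
      rw [sub_sub_cancel] at this
      linarith
  have hzero : ∀ z ∉ S, |h z| / ‖z‖ ^ r = 0 := by
    intro z hz
    simp only [S, Set.mem_union, Metric.mem_ball, dist_eq_norm, sub_neg_eq_add, not_or,
      not_lt] at hz
    rw [hsupp z (by rw [add_comm]; exact hz.1) (by rw [norm_sub_rev]; exact hz.2), abs_zero,
      zero_div]
  have hS : μ S ≠ ⊤ := ((Metric.isBounded_ball.union Metric.isBounded_ball).measure_lt_top).ne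
  have hSle : μ.real S ≤ 2 * μ.real (Metric.ball 0 R) := by
    refine (measureReal_union_le _ _).trans_eq ?_
    simp only [measureReal_def, Measure.addHaar_ball_center]
    ring
  calc ∫ z, |h z| / ‖z‖ ^ r ∂μ = ∫ z in S, |h z| / ‖z‖ ^ r ∂μ :=
        (setIntegral_eq_integral_of_forall_compl_eq_zero hzero).symm
    _ ≤ ∫ _ in S, M * (‖x‖ / 2) ^ (-r) ∂μ := by
        refine integral_mono_of_nonneg (.of_forall fun z => by positivity)
          (integrableOn_const hS) ?_
        filter_upwards [ae_restrict_mem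
          (Metric.isOpen_ball.union Metric.isOpen_ball).measurableSet] with z hz
        rw [Real.rpow_neg (by positivity), ← div_eq_mul_inv]
        exact div_le_div₀ hM (hle z) (by positivity)
          (Real.rpow_le_rpow (by positivity) (hfar z hz) hr)
    _ ≤ 2 * μ.real (Metric.ball 0 R) * M * (‖x‖ / 2) ^ (-r) := by
        rw [setIntegral_const, smul_eq_mul, ← mul_assoc]
        gcongr

theorem exists_integral_abs_div_norm_rpow_le {r R M : ℝ} (hr : (finrank ℝ E : ℝ) < r)
    (hr' : r < finrank ℝ E + 2) (hR : 1 ≤ R) (hM : 0 ≤ M) :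
    ∃ A, ∀ (x : E) (h : E → ℝ), (∀ z, |h z| ≤ M * min 1 (‖z‖ ^ 2)) →
      (∀ z, R ≤ ‖x‖ → R ≤ ‖x + z‖ → R ≤ ‖x - z‖ → h z = 0) →
      ∫ z, |h z| / ‖z‖ ^ r ∂μ ≤ A * (1 + ‖x‖) ^ (-r) := by
  have hr0 : 0 < r := (Nat.cast_nonneg _).trans_lt hr
  set K := ∫ z : E, min 1 (‖z‖ ^ 2) / ‖z‖ ^ r ∂μ
  have : 0 ≤ K := integral_nonneg fun z => by positivity
  set B := 2 * μ.real (Metric.ball (0 : E) R) * M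
  refine ⟨max (M * K * (1 + 2 * R) ^ r) (B * 4 ^ r), fun x h hle hsupp => ?_⟩
  have hx1 : 0 < 1 + ‖x‖ := by positivity
  rcases lt_or_ge ‖x‖ (2 * R) with hx | hx
  · have hone : 1 ≤ (1 + 2 * R) ^ r * (1 + ‖x‖) ^ (-r) := by
      rw [Real.rpow_neg hx1.le, ← div_eq_mul_inv, one_le_div (by positivity)]
      gcongr
    calc _ ≤ M * K := integral_abs_div_norm_rpow_le hr hr' hle
      _ ≤ M * K * ((1 + 2 * R) ^ r * (1 + ‖x‖) ^ (-r)) :=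
        le_mul_of_one_le_right (by positivity) hone
      _ ≤ _ := by
        rw [← mul_assoc]
        gcongr
        exact le_max_left _ _
  · have hquarter : (‖x‖ / 2) ^ (-r) ≤ 4 ^ r * (1 + ‖x‖) ^ (-r) := by
      have h4 : (4 : ℝ) ^ r = 4⁻¹ ^ (-r) := by
        rw [Real.inv_rpow (by norm_num), Real.rpow_neg (by norm_num), inv_inv]
      rw [h4, ← Real.mul_rpow (by norm_num) hx1.le]
      exact Real.rpow_le_rpow_of_nonpos (by positivity) (by linarith) (by linarith)
    calc _ ≤ B * (‖x‖ / 2) ^ (-r) :=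
        integral_abs_div_norm_rpow_le_of_far hr0.le (by linarith) hx
          (fun z => (hle z).trans (mul_le_of_le_one_right hM (min_le_left _ _)))
          fun z => hsupp z (by linarith)
      _ ≤ B * (4 ^ r * (1 + ‖x‖) ^ (-r)) := by gcongr
      _ ≤ _ := by
        rw [← mul_assoc]
        gcongr
        exact le_max_right _ _

/-- Peetre's inequality. -/
theorem one_add_norm_add_rpow_neg_le {F : Type*} [NormedAddCommGroup F] {q r : ℝ} (hq : 0 ≤ q)
    {t : F} (ht : ‖t‖ ≤ r) (y : F) :
    (1 + ‖y + t‖) ^ (-q) ≤ (1 + r) ^ q * (1 + ‖y‖) ^ (-q) := by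
  have hr : 0 ≤ r := (norm_nonneg t).trans ht
  have hy : ‖y‖ ≤ ‖y + t‖ + ‖t‖ := by simpa using norm_sub_le (y + t) t
  rw [Real.rpow_neg (by positivity), Real.rpow_neg (by positivity), inv_le_comm₀ (by positivity)
    (by positivity), mul_inv, inv_inv, inv_mul_le_iff₀ (by positivity),
    ← Real.mul_rpow (by positivity) (by positivity)]
  gcongr
  nlinarith [norm_nonneg (y + t)]

end Radial

/-! ### The fractional Laplacian of a test function -/

/-- The symmetric second difference of `φ` at `x` with increment `z`, the numerator of the
absolutely convergent formula for the fractional Laplacian. -/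
def secondDiff {E : Type*} [AddCommGroup E] (φ : E → ℝ) (x z : E) : ℝ :=
  2 * φ x - φ (x + z) - φ (x - z)

section SecondDiff

variable {E : Type*} [NormedAddCommGroup E]

theorem secondDiff_eq_zero {φ : E → ℝ} {R : ℝ} (hφ : ∀ x, R ≤ ‖x‖ → φ x = 0) {x z : E}
    (hx : R ≤ ‖x‖) (hadd : R ≤ ‖x + z‖) (hsub : R ≤ ‖x - z‖) : secondDiff φ x z = 0 := by
  simp only [secondDiff, hφ _ hx, hφ _ hadd, hφ _ hsub, mul_zero, sub_zero]

theorem continuous_secondDiff {φ : E → ℝ} (hφ : Continuous φ) :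
    Continuous fun p : E × E => secondDiff φ p.1 p.2 := by
  unfold secondDiff
  fun_prop

theorem exists_abs_secondDiff_le_mul_sq [NormedSpace ℝ E] {φ : E → ℝ} (hφ : ContDiff ℝ 2 φ)
    (hc : HasCompactSupport φ) : ∃ L, ∀ x z, |secondDiff φ x z| ≤ L * ‖z‖ ^ 2 := by
  obtain ⟨L, hL⟩ := (hφ.fderiv_right (m := 1) (by norm_cast)).lipschitzWith_of_hasCompactSupport
    (hc.fderiv ℝ) (by simp)
  have htaylor : ∀ x z, |φ (x + z) - φ x - fderiv ℝ φ x z| ≤ L * ‖z‖ ^ 2 := by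
    intro x z
    have := (convex_closedBall x ‖z‖).norm_image_sub_le_of_norm_fderiv_le' (𝕜 := ℝ) (f := φ)
      (φ := fderiv ℝ φ x) (C := L * ‖z‖) (x := x) (y := x + z)
      (fun y _ => hφ.differentiable (by simp) y)
      (fun y hy => (hL.norm_sub_le y x).trans (by gcongr; rwa [← dist_eq_norm]))
      (by simp) (by simp)
    rwa [add_sub_cancel_left, mul_assoc, ← sq] at this
  refine ⟨2 * L, fun x z => ?_⟩
  have hpos := abs_le.1 (htaylor x z)
  have hneg := abs_le.1 (htaylor x (-z))
  rw [norm_neg, map_neg, ← sub_eq_add_neg] at hneg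
  rw [secondDiff, abs_le]
  constructor <;> linarith [hpos.1, hpos.2, hneg.1, hneg.2]

end SecondDiff

theorem le_max_mul_min_one {u a b t : ℝ} (ht : 0 ≤ t) (ha : u ≤ a) (hb : u ≤ b * t) :
    u ≤ max a b * min 1 t := by
  rcases le_total 1 t with h | h
  · rw [min_eq_left h, mul_one]
    exact ha.trans (le_max_left _ _)
  · rw [min_eq_right h]
    exact hb.trans (by gcongr; exact le_max_right _ _)

theorem tendsto_setIntegral_lt_norm {E : Type*} [NormedAddCommGroup E] [MeasurableSpace E]
    [BorelSpace E] {μ : Measure E} {g : E → ℝ} (hg : Integrable g μ) (h0 : g 0 = 0) :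
    Tendsto (fun ε : ℝ => ∫ z in {z | ε < ‖z‖}, g z ∂μ) (𝓝[>] 0) (𝓝 (∫ z, g z ∂μ)) := by
  have hmeas (ε : ℝ) : MeasurableSet {z : E | ε < ‖z‖} :=
    measurableSet_lt measurable_const measurable_norm
  simp only [← integral_indicator (hmeas _)]
  refine tendsto_integral_filter_of_dominated_convergence _
    (.of_forall fun ε => hg.aestronglyMeasurable.indicator (hmeas ε))
    (.of_forall fun ε => .of_forall fun z => norm_indicator_le_norm_self _ _) hg.norm
    (.of_forall fun z => ?_)
  rcases eq_or_ne z 0 with rfl | hz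
  · simp only [Set.indicator_apply, h0, ite_self, tendsto_const_nhds]
  · have hlt : ∀ᶠ ε in 𝓝[>] (0 : ℝ), z ∈ {z : E | ε < ‖z‖} :=
      nhdsWithin_le_nhds (Iio_mem_nhds (norm_pos_iff.2 hz))
    exact tendsto_const_nhds.congr' (hlt.mono fun ε hε => (Set.indicator_of_mem hε g).symm)

section Truncation

variable {E : Type*} [NormedAddCommGroup E] [NormedSpace ℝ E] [FiniteDimensional ℝ E]
  [MeasurableSpace E] [BorelSpace E] {μ : Measure E} [μ.IsAddHaarMeasure]

open Module

theorem integrableOn_lt_norm_diff_div {φ : E → ℝ} {M r ε : ℝ} (hr : (finrank ℝ E : ℝ) < r)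
    (hr' : r < finrank ℝ E + 2) (hφ : Continuous φ) (hM : ∀ x, |φ x| ≤ M) (hε : 0 < ε) (x : E) :
    IntegrableOn (fun z => (φ x - φ (x + z)) / ‖z‖ ^ r) {z | ε < ‖z‖} μ := by
  have hmeas : MeasurableSet {z : E | ε < ‖z‖} := measurableSet_lt measurable_const measurable_norm
  have hc : Continuous fun z => φ x - φ (x + z) := by fun_prop
  rw [← integrable_indicator_iff hmeas]
  refine (integrable_div_norm_rpow (M := max (2 * M) (2 * M / ε ^ 2)) hr hr'
    (hc.aestronglyMeasurable.indicator hmeas) fun z => ?_).congr (.of_forall fun z => ?_)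
  · have hM0 : 0 ≤ M := (abs_nonneg _).trans (hM x)
    have hdiff : |φ x - φ (x + z)| ≤ 2 * M := by
      linarith [abs_sub (φ x) (φ (x + z)), hM x, hM (x + z)]
    by_cases hz : z ∈ {z : E | ε < ‖z‖}
    · rw [Set.indicator_of_mem hz]
      refine le_max_mul_min_one (by positivity) hdiff (hdiff.trans ?_)
      rw [div_mul_eq_mul_div, le_div_iff₀ (by positivity)]
      gcongr
      exact le_of_lt hz
    · rw [Set.indicator_of_notMem hz, abs_zero]
      positivity
  · by_cases hz : z ∈ {z : E | ε < ‖z‖}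
    · simp only [Set.indicator_of_mem hz]
    · simp only [Set.indicator_of_notMem hz, zero_div]

theorem setIntegral_lt_norm_diff_div {φ : E → ℝ} {M r ε : ℝ} (hr : (finrank ℝ E : ℝ) < r)
    (hr' : r < finrank ℝ E + 2) (hφ : Continuous φ) (hM : ∀ x, |φ x| ≤ M) (hε : 0 < ε) (x : E) :
    ∫ y in {y | ε < ‖x - y‖}, (φ x - φ y) / ‖x - y‖ ^ r ∂μ =
      2⁻¹ * ∫ z in {z | ε < ‖z‖}, secondDiff φ x z / ‖z‖ ^ r ∂μ := by
  have hmeas : MeasurableSet {z : E | ε < ‖z‖} := measurableSet_lt measurable_const measurable_norm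
  have hmeas' : MeasurableSet {y : E | ε < ‖x - y‖} :=
    measurableSet_lt measurable_const (by fun_prop)
  have hint := integrableOn_lt_norm_diff_div (μ := μ) hr hr' hφ hM hε x
  have hint' : IntegrableOn (fun z => (φ x - φ (x - z)) / ‖z‖ ^ r) {z | ε < ‖z‖} μ := by
    rw [← integrable_indicator_iff hmeas] at hint ⊢
    refine hint.comp_neg.congr (.of_forall fun z => ?_)
    simp only [Set.indicator_apply, Set.mem_ofPred_eq, norm_neg, ← sub_eq_add_neg]
  have hadd : ∫ y in {y | ε < ‖x - y‖}, (φ x - φ y) / ‖x - y‖ ^ r ∂μ =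
      ∫ z in {z | ε < ‖z‖}, (φ x - φ (x + z)) / ‖z‖ ^ r ∂μ := by
    rw [← integral_indicator hmeas', ← integral_indicator hmeas, ← integral_add_left_eq_self _ x]
    simp only [Set.indicator_apply, Set.mem_ofPred_eq, sub_add_cancel_left, norm_neg]
  have hsub : ∫ y in {y | ε < ‖x - y‖}, (φ x - φ y) / ‖x - y‖ ^ r ∂μ =
      ∫ z in {z | ε < ‖z‖}, (φ x - φ (x - z)) / ‖z‖ ^ r ∂μ := by
    rw [← integral_indicator hmeas', ← integral_indicator hmeas, ← integral_sub_left_eq_self _ μ x]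
    simp only [Set.indicator_apply, Set.mem_ofPred_eq, sub_sub_cancel]
  have hsum : ∫ z in {z | ε < ‖z‖}, secondDiff φ x z / ‖z‖ ^ r ∂μ =
      ∫ z in {z | ε < ‖z‖}, (φ x - φ (x + z)) / ‖z‖ ^ r ∂μ +
        ∫ z in {z | ε < ‖z‖}, (φ x - φ (x - z)) / ‖z‖ ^ r ∂μ := by
    rw [← integral_add hint hint']
    refine integral_congr_ae (.of_forall fun z => ?_)
    simp only [secondDiff]
    ring
  rw [hsum, ← hadd, ← hsub]
  ring

end Truncation

variable {d : ℕ} {s : ℝ}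

theorem finrank_Rd_lt (hs0 : 0 < s) : (Module.finrank ℝ (Rd d) : ℝ) < d + 2 * s := by
  rw [finrank_euclideanSpace_fin]
  linarith

theorem lt_finrank_Rd_add_two (hs1 : s < 1) :
    (d : ℝ) + 2 * s < Module.finrank ℝ (Rd d) + 2 := by
  rw [finrank_euclideanSpace_fin]
  linarith

theorem fracConst_pos (hs0 : 0 < s) (hs1 : s < 1) : 0 < fracConst d s := by
  have : 0 < Real.Gamma ((d : ℝ) / 2 + s) := Real.Gamma_pos_of_pos (by positivity)
  have : 0 < Real.Gamma (1 - s) := Real.Gamma_pos_of_pos (by linarith)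
  have := Real.pi_pos
  unfold fracConst
  positivity

namespace IsTest

variable {φ : Rd d → ℝ}

theorem continuous (hφ : IsTest φ) : Continuous φ := hφ.1.continuous

theorem exists_eq_zero_of_le_norm (hφ : IsTest φ) :
    ∃ R, 1 ≤ R ∧ ∀ x, R ≤ ‖x‖ → φ x = 0 := by
  obtain ⟨R, -, hR⟩ := hφ.2.exists_pos_le_norm
  exact ⟨max 1 R, le_max_left _ _, fun x hx => hR x ((le_max_right _ _).trans hx)⟩

theorem exists_abs_le (hφ : IsTest φ) : ∃ M, ∀ x, |φ x| ≤ M :=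
  hφ.2.exists_bound_of_continuous hφ.continuous

theorem exists_abs_secondDiff_le (hφ : IsTest φ) :
    ∃ M, 0 ≤ M ∧ ∀ x z, |secondDiff φ x z| ≤ M * min 1 (‖z‖ ^ 2) := by
  obtain ⟨M, hM⟩ := hφ.exists_abs_le
  obtain ⟨L, hL⟩ := exists_abs_secondDiff_le_mul_sq (contDiff_infty.1 hφ.1 2) hφ.2
  have hM0 : 0 ≤ M := (abs_nonneg _).trans (hM 0)
  refine ⟨max (4 * M) L, by positivity,
    fun x z => le_max_mul_min_one (by positivity) ?_ (hL x z)⟩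
  have hx := abs_le.1 (hM x)
  have hadd := abs_le.1 (hM (x + z))
  have hsub := abs_le.1 (hM (x - z))
  rw [secondDiff, abs_le]
  constructor <;> linarith [hx.1, hx.2, hadd.1, hadd.2, hsub.1, hsub.2]

theorem exists_sq_diff_le (hφ : IsTest φ) :
    ∃ M, 0 ≤ M ∧ ∀ x z, (φ x - φ (x + z)) ^ 2 ≤ M * min 1 (‖z‖ ^ 2) := by
  obtain ⟨M, hM⟩ := hφ.exists_abs_le
  obtain ⟨L, hL⟩ := hφ.1.lipschitzWith_of_hasCompactSupport hφ.2 (by simp)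
  refine ⟨max ((2 * M) ^ 2) (L ^ 2), by positivity, fun x z => ?_⟩
  rw [← sq_abs]
  refine le_max_mul_min_one (by positivity) ?_ ?_
  · gcongr
    linarith [abs_sub (φ x) (φ (x + z)), hM x, hM (x + z)]
  · rw [← mul_pow]
    gcongr
    simpa only [Real.dist_eq, dist_self_add_right] using hL.dist_le_mul x (x + z)

theorem integrable_secondDiff_div (hφ : IsTest φ) (hs0 : 0 < s) (hs1 : s < 1) (x : Rd d) :
    Integrable fun z => secondDiff φ x z / ‖z‖ ^ ((d : ℝ) + 2 * s) := by
  obtain ⟨M, -, hM⟩ := hφ.exists_abs_secondDiff_le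
  exact integrable_div_norm_rpow (finrank_Rd_lt hs0) (lt_finrank_Rd_add_two hs1)
    ((continuous_secondDiff hφ.continuous).comp
      (Continuous.prodMk_right x)).aestronglyMeasurable (hM x)

theorem fracLap_eq (hφ : IsTest φ) (hs0 : 0 < s) (hs1 : s < 1) (x : Rd d) :
    fracLap s φ x =
      fracConst d s / 2 * ∫ z, secondDiff φ x z / ‖z‖ ^ ((d : ℝ) + 2 * s) := by
  obtain ⟨M, hM⟩ := hφ.exists_abs_le
  refine Tendsto.limUnder_eq ?_
  rw [div_eq_mul_inv, mul_assoc]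
  refine (((tendsto_setIntegral_lt_norm (hφ.integrable_secondDiff_div hs0 hs1 x) ?_).const_mul
    2⁻¹).const_mul _).congr' ?_
  · simp only [secondDiff, add_zero, sub_zero]
    ring
  · filter_upwards [self_mem_nhdsWithin] with ε hε
    rw [setIntegral_lt_norm_diff_div (finrank_Rd_lt hs0) (lt_finrank_Rd_add_two hs1)
      hφ.continuous hM hε]

theorem exists_integral_abs_secondDiff_le (hφ : IsTest φ) (hs0 : 0 < s) (hs1 : s < 1) :
    ∃ A, ∀ x, ∫ z, |secondDiff φ x z| / ‖z‖ ^ ((d : ℝ) + 2 * s) ≤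
      A * (1 + ‖x‖) ^ (-((d : ℝ) + 2 * s)) := by
  obtain ⟨R, hR, hzero⟩ := hφ.exists_eq_zero_of_le_norm
  obtain ⟨M, hM0, hM⟩ := hφ.exists_abs_secondDiff_le
  obtain ⟨A, hA⟩ := exists_integral_abs_div_norm_rpow_le (μ := (volume : Measure (Rd d)))
    (finrank_Rd_lt hs0) (lt_finrank_Rd_add_two hs1) hR hM0
  exact ⟨A, fun x => hA x _ (hM x) fun z hx => secondDiff_eq_zero hzero hx⟩

theorem exists_integral_sq_diff_le (hφ : IsTest φ) (hs0 : 0 < s) (hs1 : s < 1) :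
    ∃ A, ∀ x, ∫ z, (φ x - φ (x + z)) ^ 2 / ‖z‖ ^ ((d : ℝ) + 2 * s) ≤
      A * (1 + ‖x‖) ^ (-((d : ℝ) + 2 * s)) := by
  obtain ⟨R, hR, hzero⟩ := hφ.exists_eq_zero_of_le_norm
  obtain ⟨M, hM0, hM⟩ := hφ.exists_sq_diff_le
  obtain ⟨A, hA⟩ := exists_integral_abs_div_norm_rpow_le (μ := (volume : Measure (Rd d)))
    (finrank_Rd_lt hs0) (lt_finrank_Rd_add_two hs1) hR hM0
  refine ⟨A, fun x => ?_⟩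
  have := hA x (fun z => (φ x - φ (x + z)) ^ 2) (fun z => by rw [abs_sq]; exact hM x z)
    fun z hx hadd _ => by rw [hzero _ hx, hzero _ hadd, sub_zero, zero_pow two_ne_zero]
  simpa only [abs_sq] using this

theorem exists_abs_fracLap_le (hφ : IsTest φ) (hs0 : 0 < s) (hs1 : s < 1) :
    ∃ A, ∀ x, |fracLap s φ x| ≤ A * (1 + ‖x‖) ^ (-((d : ℝ) + 2 * s)) := by
  obtain ⟨A, hA⟩ := hφ.exists_integral_abs_secondDiff_le hs0 hs1
  have hC := fracConst_pos (d := d) hs0 hs1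
  refine ⟨fracConst d s / 2 * A, fun x => ?_⟩
  rw [hφ.fracLap_eq hs0 hs1, abs_mul, abs_of_pos (half_pos hC), mul_assoc]
  gcongr
  refine (abs_integral_le_integral_abs).trans (le_trans (le_of_eq ?_) (hA x))
  refine integral_congr_ae (.of_forall fun z => ?_)
  simp only [abs_div, abs_of_nonneg (Real.rpow_nonneg (norm_nonneg z) _)]

theorem stronglyMeasurable_fracLap (hφ : IsTest φ) (hs0 : 0 < s) (hs1 : s < 1) :
    StronglyMeasurable (fracLap s φ) := by
  rw [funext (hφ.fracLap_eq hs0 hs1)]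
  have hpow : Measurable fun p : Rd d × Rd d => ‖p.2‖ ^ ((d : ℝ) + 2 * s) := by fun_prop
  exact (((continuous_secondDiff hφ.continuous).measurable.div
    hpow).stronglyMeasurable.integral_prod_right').const_mul _

end IsTest

/-! ### The Gagliardo form -/

section Shear

variable {G : Type*} [AddGroup G] [MeasurableSpace G] [MeasurableAdd₂ G] [MeasurableNeg G]
  {μ ν : Measure G} [SFinite μ] [SFinite ν] [ν.IsAddLeftInvariant]

theorem integrable_prod_comp_add_iff {f : G × G → ℝ} :
    Integrable (fun p => f (p.1, p.1 + p.2)) (μ.prod ν) ↔ Integrable f (μ.prod ν) :=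
  (measurePreserving_prod_add μ ν).integrable_comp_emb
    (MeasurableEquiv.shearAddRight G).measurableEmbedding

theorem integral_prod_comp_add (f : G × G → ℝ) :
    ∫ p, f (p.1, p.1 + p.2) ∂μ.prod ν = ∫ p, f p ∂μ.prod ν :=
  (measurePreserving_prod_add μ ν).integral_comp
    (MeasurableEquiv.shearAddRight G).measurableEmbedding f

end Shear

theorem integrable_prod_mul_of_integral_abs_le {α β : Type*} [MeasurableSpace α]
    [MeasurableSpace β] {μ : Measure α} {ν : Measure β} [SFinite ν]
    {a B : α → ℝ} {h : α × β → ℝ} (ha : AEStronglyMeasurable a μ)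
    (hh : AEStronglyMeasurable h (μ.prod ν)) (hint : ∀ x, Integrable (fun z => h (x, z)) ν)
    (hB : ∀ x, ∫ z, |h (x, z)| ∂ν ≤ B x) (haB : Integrable (fun x => a x * B x) μ) :
    Integrable (fun p => a p.1 * h p) (μ.prod ν) := by
  have hm : AEStronglyMeasurable (fun p : α × β => a p.1 * h p) (μ.prod ν) := ha.comp_fst.mul hh
  refine (integrable_prod_iff hm).2 ⟨.of_forall fun x => (hint x).const_mul (a x),
    haB.mono hm.norm.integral_prod_right' (.of_forall fun x => ?_)⟩
  simp only [norm_mul, Real.norm_eq_abs, integral_const_mul, abs_abs]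
  rw [abs_of_nonneg (integral_nonneg fun z => abs_nonneg _)]
  gcongr
  exact (hB x).trans (le_abs_self _)

theorem integral_mul_secondDiff {E : Type*} [NormedAddCommGroup E] [MeasurableSpace E]
    [BorelSpace E] {μ : Measure E} [μ.IsAddRightInvariant] {u φ : E → ℝ}
    (hu : LocallyIntegrable u μ) (hφ : Continuous φ) (hc : HasCompactSupport φ) (z : E) :
    ∫ x, u x * secondDiff φ x z ∂μ =
      ∫ x, (u x - u (x + z)) * (φ x - φ (x + z)) ∂μ := by
  have hint (t : E) : Integrable (fun x => u x * φ (x + t)) μ :=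
    hu.integrable_smul_right_of_hasCompactSupport (by fun_prop)
      (hc.comp_homeomorph (Homeomorph.addRight t))
  have h0 : Integrable (fun x => u x * φ x) μ := by simpa only [add_zero] using hint 0
  have hsub : Integrable (fun x => u x * φ (x - z)) μ := by
    simpa only [← sub_eq_add_neg] using hint (-z)
  have hshift : Integrable (fun x => u (x + z) * φ x) μ := by
    simpa only [add_sub_cancel_right] using hsub.comp_add_right z
  have hshift' : Integrable (fun x => u (x + z) * φ (x + z)) μ := h0.comp_add_right z
  have heq : ∫ x, u (x + z) * φ x ∂μ = ∫ x, u x * φ (x - z) ∂μ := by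
    simpa only [add_sub_cancel_right] using
      integral_add_right_eq_self (fun x => u x * φ (x - z)) z
  have hleft : ∫ x, u x * secondDiff φ x z ∂μ =
      2 * ∫ x, u x * φ x ∂μ - ∫ x, u x * φ (x + z) ∂μ - ∫ x, u x * φ (x - z) ∂μ := by
    rw [← integral_const_mul, ← integral_sub (h0.const_mul 2) (hint z),
      ← integral_sub (by exact (h0.const_mul 2).sub (hint z)) hsub]
    congr with x
    simp only [secondDiff]
    ring
  have hright : ∫ x, (u x - u (x + z)) * (φ x - φ (x + z)) ∂μ =
      ∫ x, u x * φ x ∂μ - ∫ x, u x * φ (x + z) ∂μ -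
        (∫ x, u (x + z) * φ x ∂μ - ∫ x, u (x + z) * φ (x + z) ∂μ) := by
    rw [← integral_sub h0 (hint z), ← integral_sub hshift hshift',
      ← integral_sub (by exact h0.sub (hint z)) (by exact hshift.sub hshift')]
    congr with x
    ring
  rw [hleft, hright, heq, integral_add_right_eq_self (fun x => u x * φ x)]
  ring

variable {q : ℝ} {v w : Rd d → ℝ}

/-- `v ∈ L¹((1 + |x|)^(-q) dx)`. With `q = d + 2s` this is the natural class of functions whose
distributional fractional Laplacian makes sense. -/
def MemL1Decay (q : ℝ) (v : Rd d → ℝ) : Prop :=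
  Integrable fun x => v x * (1 + ‖x‖) ^ (-q)

theorem continuous_one_add_norm_rpow {E : Type*} [SeminormedAddCommGroup E] (q : ℝ) :
    Continuous fun x : E => (1 + ‖x‖) ^ q :=
  (continuous_const.add continuous_norm).rpow_const fun x =>
    .inl (add_pos_of_pos_of_nonneg one_pos (norm_nonneg x)).ne'

theorem MemL1Decay.locallyIntegrable (hv : MemL1Decay q v) : LocallyIntegrable v := by
  refine locallyIntegrable_iff.2 fun K hK => ?_
  refine (hv.integrableOn.mul_continuousOn (continuous_one_add_norm_rpow q).continuousOn hK).congr
    (.of_forall fun x => ?_)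
  simp only
  rw [Real.rpow_neg (by positivity), inv_mul_cancel_right₀ (by positivity)]

/-- The difference quotient `(v x - v y) / |x - y|^((d + 2s) / 2)`, whose `L²` norm is the
Gagliardo seminorm of `v`. -/
def diffQuot (s : ℝ) (v : Rd d → ℝ) (z : Rd d × Rd d) : ℝ :=
  (v z.1 - v z.2) * ‖z.1 - z.2‖ ^ (-(((d : ℝ) + 2 * s) / 2))

theorem diffQuot_mul_diffQuot (s : ℝ) (v w : Rd d → ℝ) (z : Rd d × Rd d) :
    diffQuot s v z * diffQuot s w z = gagliardoIntegrand s v w z.1 z.2 := by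
  rw [diffQuot, diffQuot, gagliardoIntegrand]
  rcases eq_or_ne z.1 z.2 with h | h
  · rw [h, sub_self, zero_mul, zero_mul, zero_mul, zero_div]
  · have hpos : 0 < ‖z.1 - z.2‖ := norm_pos_iff.2 (sub_ne_zero.2 h)
    rw [mul_mul_mul_comm, ← Real.rpow_add hpos, ← neg_add, add_halves, Real.rpow_neg hpos.le,
      div_eq_mul_inv]

theorem diffQuot_sq (s : ℝ) (v : Rd d → ℝ) (z : Rd d × Rd d) :
    diffQuot s v z ^ 2 = (v z.1 - v z.2) ^ 2 / ‖z.1 - z.2‖ ^ ((d : ℝ) + 2 * s) := by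
  rw [sq, diffQuot_mul_diffQuot, gagliardoIntegrand, ← sq]

theorem diffQuot_add_sq (s : ℝ) (v : Rd d → ℝ) (x z : Rd d) :
    diffQuot s v (x, x + z) ^ 2 = (v x - v (x + z)) ^ 2 / ‖z‖ ^ ((d : ℝ) + 2 * s) := by
  rw [diffQuot_sq, sub_add_cancel_left, norm_neg]

theorem diffQuot_sub (s : ℝ) (v w : Rd d → ℝ) :
    diffQuot s (v - w) = diffQuot s v - diffQuot s w := by
  ext z
  simp only [diffQuot, Pi.sub_apply]
  ring

theorem aestronglyMeasurable_diffQuot (s : ℝ) (hv : AEStronglyMeasurable v) :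
    AEStronglyMeasurable (diffQuot s v) (volume.prod volume) := by
  have : Measurable fun z : Rd d × Rd d => ‖z.1 - z.2‖ ^ (-(((d : ℝ) + 2 * s) / 2)) := by
    fun_prop
  exact (hv.comp_fst.sub hv.comp_snd).mul this.aestronglyMeasurable

theorem hdotNormSq_eq (hv : AEStronglyMeasurable v) :
    hdotNormSq s v = ENNReal.ofReal (fracConst d s / 2) *
      eLpNorm (diffQuot s v) 2 (volume.prod volume) ^ 2 := by
  have hpow : eLpNorm (diffQuot s v) 2 (volume.prod volume) ^ 2 =
      ∫⁻ z, ‖diffQuot s v z‖ₑ ^ 2 ∂volume.prod volume := by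
    simpa using eLpNorm_nnreal_pow_eq_lintegral (p := 2) (f := diffQuot s v)
      (μ := volume.prod volume) two_ne_zero
  rw [hdotNormSq, hpow, lintegral_prod _
    ((aestronglyMeasurable_diffQuot s hv).enorm.pow_const 2)]
  simp only [← enorm_pow, diffQuot_sq]
  refine congrArg _ (lintegral_congr fun x => lintegral_congr fun y => ?_)
  exact (Real.enorm_of_nonneg
    (div_nonneg (sq_nonneg _) (Real.rpow_nonneg (norm_nonneg (x - y)) _))).symm

theorem gagliardoIntegrand_comm (v w : Rd d → ℝ) :
    gagliardoIntegrand s v w = gagliardoIntegrand s w v := by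
  ext x y
  rw [gagliardoIntegrand, gagliardoIntegrand, mul_comm (v x - v y)]

theorem integrable_gagliardoIntegrand (hv : MemLp (diffQuot s v) 2 (volume.prod volume))
    (hw : MemLp (diffQuot s w) 2 (volume.prod volume)) :
    Integrable (fun z : Rd d × Rd d => gagliardoIntegrand s v w z.1 z.2) (volume.prod volume) :=
  (hv.integrable_mul hw).congr (.of_forall fun z => diffQuot_mul_diffQuot s v w z)

namespace IsTest

variable {φ : Rd d → ℝ}

theorem memLp_diffQuot (hφ : IsTest φ) (hs0 : 0 < s) (hs1 : s < 1) :
    MemLp (diffQuot s φ) 2 (volume.prod volume) := by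
  have hm := aestronglyMeasurable_diffQuot s hφ.continuous.aestronglyMeasurable
  obtain ⟨M, -, hM⟩ := hφ.exists_sq_diff_le
  obtain ⟨A, hA⟩ := hφ.exists_integral_sq_diff_le hs0 hs1
  rw [memLp_two_iff_integrable_sq hm, ← integrable_prod_comp_add_iff]
  have hc := hφ.continuous
  have hnum : Measurable fun p : Rd d × Rd d => (φ p.1 - φ (p.1 + p.2)) ^ 2 :=
    Continuous.measurable (by fun_prop)
  have hden : Measurable fun p : Rd d × Rd d => ‖p.2‖ ^ ((d : ℝ) + 2 * s) := by fun_prop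
  have hone : Integrable fun x : Rd d => 1 * (A * (1 + ‖x‖) ^ (-((d : ℝ) + 2 * s))) := by
    simpa only [one_mul] using (integrable_one_add_norm (finrank_Rd_lt hs0)).const_mul A
  refine (integrable_prod_mul_of_integral_abs_le (μ := volume) (ν := volume)
    (h := fun p : Rd d × Rd d => (φ p.1 - φ (p.1 + p.2)) ^ 2 / ‖p.2‖ ^ ((d : ℝ) + 2 * s))
    aestronglyMeasurable_const (hnum.div hden).aestronglyMeasurable
    (fun x => integrable_div_norm_rpow (finrank_Rd_lt hs0) (lt_finrank_Rd_add_two hs1)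
      (Continuous.aestronglyMeasurable (by fun_prop)) fun z => by rw [abs_sq]; exact hM x z)
    (fun x => ?_) hone).congr (.of_forall fun p => ?_)
  · simpa only [abs_div, abs_sq, abs_of_nonneg (Real.rpow_nonneg (norm_nonneg _) _)] using hA x
  · simp only [diffQuot_add_sq, one_mul]

theorem integrable_prod_mul_secondDiff (hφ : IsTest φ) (hs0 : 0 < s) (hs1 : s < 1)
    (hv : MemL1Decay (d + 2 * s) v) :
    Integrable (fun p : Rd d × Rd d =>
      v p.1 * (secondDiff φ p.1 p.2 / ‖p.2‖ ^ ((d : ℝ) + 2 * s))) (volume.prod volume) := by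
  obtain ⟨A, hA⟩ := hφ.exists_integral_abs_secondDiff_le hs0 hs1
  have hden : Measurable fun p : Rd d × Rd d => ‖p.2‖ ^ ((d : ℝ) + 2 * s) := by fun_prop
  refine integrable_prod_mul_of_integral_abs_le
    (h := fun p : Rd d × Rd d => secondDiff φ p.1 p.2 / ‖p.2‖ ^ ((d : ℝ) + 2 * s))
    hv.locallyIntegrable.aestronglyMeasurable
    ((continuous_secondDiff hφ.continuous).measurable.div hden).aestronglyMeasurable
    (hφ.integrable_secondDiff_div hs0 hs1) (fun x => ?_)
    ((hv.const_mul A).congr (.of_forall fun x => mul_left_comm _ _ _))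
  simpa only [abs_div, abs_of_nonneg (Real.rpow_nonneg (norm_nonneg _) _)] using hA x

theorem integral_mul_fracLap (hφ : IsTest φ) (hs0 : 0 < s) (hs1 : s < 1)
    (hv : MemL1Decay (d + 2 * s) v)
    (hG : Integrable (fun z : Rd d × Rd d => gagliardoIntegrand s v φ z.1 z.2)
      (volume.prod volume)) :
    ∫ x, v x * fracLap s φ x =
      fracConst d s / 2 * ∫ z, gagliardoIntegrand s v φ z.1 z.2 ∂(volume.prod volume) := by
  set r : ℝ := d + 2 * s
  calc ∫ x, v x * fracLap s φ x
      = fracConst d s / 2 * ∫ x, ∫ z, v x * (secondDiff φ x z / ‖z‖ ^ r) := by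
        rw [← integral_const_mul]
        congr with x
        rw [hφ.fracLap_eq hs0 hs1, integral_const_mul, mul_left_comm]
    _ = fracConst d s / 2 * ∫ z, ∫ x, v x * (secondDiff φ x z / ‖z‖ ^ r) := by
        rw [integral_integral_swap (hφ.integrable_prod_mul_secondDiff hs0 hs1 hv)]
    _ = fracConst d s / 2 * ∫ z, ∫ x, gagliardoIntegrand s v φ x (x + z) := by
        congr! 3 with z
        simp only [gagliardoIntegrand, sub_add_cancel_left, norm_neg, ← mul_div_assoc,
          integral_div]
        rw [integral_mul_secondDiff hv.locallyIntegrable hφ.continuous hφ.2]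
    _ = _ := by
        rw [← integral_prod_comp_add, integral_prod_symm _ (integrable_prod_comp_add_iff.2 hG)]

end IsTest

/-! ### Mollification -/

section Mollify

variable {E : Type*} [NormedAddCommGroup E] [NormedSpace ℝ E] [HasContDiffBump E]
  [MeasurableSpace E]

/-- The mollification of `u`: its convolution with the normalized bump function `b`. -/
def mollify (μ : Measure E) (b : ContDiffBump (0 : E)) (u : E → ℝ) : E → ℝ :=
  convolution (b.normed μ) u (ContinuousLinearMap.lsmul ℝ ℝ) μ

theorem normed_eq_zero {μ : Measure E} (b : ContDiffBump (0 : E)) {t : E} (ht : b.rOut ≤ ‖t‖) :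
    b.normed μ t = 0 := by
  rw [ContDiffBump.normed_def, b.zero_of_le_dist (by rwa [dist_zero_right]), zero_div]

variable [FiniteDimensional ℝ E] [BorelSpace E] {μ : Measure E} [μ.IsAddHaarMeasure]
  (b : ContDiffBump (0 : E)) {u g : E → ℝ}

theorem mollify_apply (u : E → ℝ) (x : E) :
    mollify μ b u x = ∫ t, b.normed μ t * u (x + t) ∂μ := by
  rw [← integral_neg_eq_self]
  simp only [b.normed_neg, ← sub_eq_add_neg]
  rfl

theorem mollify_apply_eq_integral_sub_mul (u : E → ℝ) (x : E) :
    mollify μ b u x = ∫ y, b.normed μ (x - y) * u y ∂μ := by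
  rw [mollify, convolution_eq_swap]
  rfl

theorem integrable_normed_mul_comp_add (hu : LocallyIntegrable u μ) (x : E) :
    Integrable (fun t => b.normed μ t * u (x + t)) μ := by
  have hconv : Integrable (fun t => b.normed μ t * u (x - t)) μ :=
    b.hasCompactSupport_normed.convolutionExists_left (ContinuousLinearMap.lsmul ℝ ℝ)
      b.continuous_normed hu x
  have := hconv.comp_neg
  simpa only [b.normed_neg, sub_neg_eq_add] using this

theorem mollify_sub {w : E → ℝ} (hu : LocallyIntegrable u μ) (hw : LocallyIntegrable w μ) :
    mollify μ b (u - w) = mollify μ b u - mollify μ b w := by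
  ext x
  simp only [Pi.sub_apply, mollify_apply, mul_sub]
  exact integral_sub (integrable_normed_mul_comp_add b hu x)
    (integrable_normed_mul_comp_add b hw x)

theorem contDiff_mollify (hu : LocallyIntegrable u μ) : ContDiff ℝ ∞ (mollify μ b u) :=
  b.hasCompactSupport_normed.contDiff_convolution_left _ b.contDiff_normed hu

theorem mollify_eq_zero {R : ℝ} (hu : ∀ x, R ≤ ‖x‖ → u x = 0) {x : E} (hx : R + b.rOut ≤ ‖x‖) :
    mollify μ b u x = 0 := by
  rw [mollify_apply]
  refine integral_eq_zero_of_ae (.of_forall fun t => ?_)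
  rcases le_total b.rOut ‖t‖ with h | h
  · simp only [normed_eq_zero b h, zero_mul, Pi.zero_apply]
  · have := norm_sub_le (x + t) t
    rw [add_sub_cancel_right] at this
    simp only [hu (x + t) (by linarith), mul_zero, Pi.zero_apply]

theorem integrable_prod_mul_normed_mul {B : E → ℝ} (hu : AEStronglyMeasurable u μ)
    (hg : Measurable g) (hB : ∀ y t, ‖t‖ ≤ b.rOut → |g (y + t)| ≤ B y)
    (huB : Integrable (fun y => u y * B y) μ) :
    Integrable (fun p : E × E => u p.1 * (b.normed μ p.2 * g (p.1 + p.2))) (μ.prod μ) := by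
  have hb : Measurable (b.normed μ) := b.continuous_normed.measurable
  have hle (y t : E) : |b.normed μ t * g (y + t)| ≤ b.normed μ t * B y := by
    rw [abs_mul, abs_of_nonneg (b.nonneg_normed t)]
    rcases le_total b.rOut ‖t‖ with h | h
    · rw [normed_eq_zero b h, zero_mul, zero_mul]
    · exact mul_le_mul_of_nonneg_left (hB y t h) (b.nonneg_normed t)
  have hdom (y : E) : Integrable (fun t => b.normed μ t * B y) μ := b.integrable_normed.mul_const _
  have hint (y : E) : Integrable (fun t => b.normed μ t * g (y + t)) μ :=
    (hdom y).mono' (Measurable.aestronglyMeasurable (by fun_prop)) (.of_forall (hle y))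
  refine integrable_prod_mul_of_integral_abs_le (h := fun p => b.normed μ p.2 * g (p.1 + p.2)) hu
    (Measurable.aestronglyMeasurable (by fun_prop)) hint (fun y => ?_) huB
  refine (integral_mono (hint y).abs (hdom y) (hle y)).trans_eq ?_
  rw [integral_mul_const, b.integral_normed, one_mul]

variable {b} in
theorem integral_mollify_mul
    (h : Integrable (fun p : E × E => u p.1 * (b.normed μ p.2 * g (p.1 + p.2))) (μ.prod μ)) :
    ∫ x, mollify μ b u x * g x ∂μ = ∫ x, u x * mollify μ b g x ∂μ := by
  have h' : Integrable (fun p : E × E => u p.1 * (b.normed μ (p.2 - p.1) * g p.2)) (μ.prod μ) :=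
    integrable_prod_comp_add_iff.1 (by simpa only [add_sub_cancel_left] using h)
  calc ∫ x, mollify μ b u x * g x ∂μ
      = ∫ x, ∫ y, u y * (b.normed μ (x - y) * g x) ∂μ ∂μ := by
        congr with x
        rw [mollify_apply_eq_integral_sub_mul, ← integral_mul_const]
        congr with y
        ring
    _ = ∫ y, ∫ x, u y * (b.normed μ (x - y) * g x) ∂μ ∂μ := (integral_integral_swap h').symm
    _ = ∫ y, u y * mollify μ b g y ∂μ := by
        congr with y
        rw [integral_const_mul, mollify_apply_eq_integral_sub_mul]
        simp only [← neg_sub y, b.normed_neg]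

variable {b} in
theorem integral_mul_mollify
    (h : Integrable (fun p : E × E => u p.1 * (b.normed μ p.2 * g (p.1 + p.2))) (μ.prod μ)) :
    ∫ x, u x * mollify μ b g x ∂μ = ∫ t, b.normed μ t * ∫ x, u x * g (x + t) ∂μ ∂μ := by
  simp only [mollify_apply, ← integral_const_mul]
  rw [integral_integral_swap h]
  congr! 4
  ring

end Mollify

section MollifyFracLap

variable {φ f : Rd d → ℝ}

namespace IsTest

theorem mollify (hφ : IsTest φ) (b : ContDiffBump (0 : Rd d)) : IsTest (mollify volume b φ) :=
  ⟨contDiff_mollify b hφ.continuous.locallyIntegrable,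
    b.hasCompactSupport_normed.convolution _ hφ.2⟩

theorem comp_add_right (hφ : IsTest φ) (t : Rd d) : IsTest fun x => φ (x + t) :=
  ⟨hφ.1.comp (contDiff_id.add contDiff_const), hφ.2.comp_homeomorph (Homeomorph.addRight t)⟩

theorem fracLap_comp_add_right (hφ : IsTest φ) (hs0 : 0 < s) (hs1 : s < 1) (t x : Rd d) :
    fracLap s (fun y => φ (y + t)) x = fracLap s φ (x + t) := by
  rw [(hφ.comp_add_right t).fracLap_eq hs0 hs1, hφ.fracLap_eq hs0 hs1]
  simp only [secondDiff, add_right_comm _ t, sub_add_eq_add_sub]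

theorem integrable_prod_mul_normed_mul_fracLap (hφ : IsTest φ) (hs0 : 0 < s) (hs1 : s < 1)
    (b : ContDiffBump (0 : Rd d)) (hv : MemL1Decay (d + 2 * s) v) :
    Integrable (fun p : Rd d × Rd d =>
      v p.1 * (b.normed volume p.2 * fracLap s φ (p.1 + p.2))) (volume.prod volume) := by
  obtain ⟨A, hA⟩ := hφ.exists_abs_fracLap_le hs0 hs1
  have hA0 : 0 ≤ A := by simpa using (abs_nonneg _).trans (hA 0)
  refine integrable_prod_mul_normed_mul b (B := fun y =>
      A * ((1 + b.rOut) ^ ((d : ℝ) + 2 * s) * (1 + ‖y‖) ^ (-((d : ℝ) + 2 * s))))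
    hv.locallyIntegrable.aestronglyMeasurable (hφ.stronglyMeasurable_fracLap hs0 hs1).measurable
    (fun y t ht => (hA _).trans ?_) ?_
  · gcongr
    exact one_add_norm_add_rpow_neg_le (by positivity) ht y
  · simpa only [mul_assoc, mul_left_comm (v _)] using
      (hv.const_mul ((1 + b.rOut) ^ ((d : ℝ) + 2 * s))).const_mul A

theorem integrable_prod_mul_normed_mul (hφ : IsTest φ) (b : ContDiffBump (0 : Rd d))
    (hf : LocallyIntegrable f) :
    Integrable (fun p : Rd d × Rd d =>
      f p.1 * (b.normed volume p.2 * φ (p.1 + p.2))) (volume.prod volume) := by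
  obtain ⟨M, hM⟩ := hφ.exists_abs_le
  obtain ⟨R, -, hR⟩ := hφ.exists_eq_zero_of_le_norm
  have hM0 : 0 ≤ M := (abs_nonneg _).trans (hM 0)
  set K := Metric.closedBall (0 : Rd d) (R + b.rOut)
  have hK : MeasurableSet K := Metric.isClosed_closedBall.measurableSet
  refine WeightedFracLap.integrable_prod_mul_normed_mul b (B := K.indicator fun _ => M)
    hf.aestronglyMeasurable hφ.continuous.measurable (fun y t ht => ?_) ?_
  · by_cases hy : y ∈ K
    · rw [Set.indicator_of_mem hy]
      exact hM _
    · rw [mem_closedBall_zero_iff, not_le] at hy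
      have := norm_sub_le (y + t) t
      rw [add_sub_cancel_right] at this
      rw [hR (y + t) (by linarith), abs_zero]
      exact Set.indicator_nonneg (fun _ _ => hM0) y
  · have hfK : IntegrableOn f K := hf.integrableOn_isCompact (isCompact_closedBall _ _)
    refine ((hfK.integrable_indicator hK).mul_const M).congr (.of_forall fun y => ?_)
    by_cases hy : y ∈ K
    · simp only [Set.indicator_of_mem hy]
    · simp only [Set.indicator_of_notMem hy, zero_mul, mul_zero]

end IsTest

theorem IsDistribFracLap.integral_mollify_mul_fracLap (hvf : IsDistribFracLap s v f)
    (hs0 : 0 < s) (hs1 : s < 1) (hv : MemL1Decay (d + 2 * s) v) (hf : LocallyIntegrable f)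
    (hφ : IsTest φ) (b : ContDiffBump (0 : Rd d)) :
    ∫ x, mollify volume b v x * fracLap s φ x = ∫ x, f x * mollify volume b φ x := by
  have hvφ := hφ.integrable_prod_mul_normed_mul_fracLap hs0 hs1 b hv
  rw [integral_mollify_mul hvφ, integral_mul_mollify hvφ,
    integral_mul_mollify (hφ.integrable_prod_mul_normed_mul b hf)]
  simp only [← hvf _ (hφ.comp_add_right _), hφ.fracLap_comp_add_right hs0 hs1]

end MollifyFracLap

/-! ### Mollification in weighted Lebesgue spaces -/

theorem enorm_integral_rpow_le {α : Type*} [MeasurableSpace α] {P : Measure α}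
    [IsProbabilityMeasure P] {u : α → ℝ} (hu : AEStronglyMeasurable u P) {p : ℝ} (hp : 1 ≤ p) :
    ‖∫ x, u x ∂P‖ₑ ^ p ≤ ∫⁻ x, ‖u x‖ₑ ^ p ∂P := by
  have hp0 : 0 < p := one_pos.trans_le hp
  have hnorm : eLpNorm u 1 P ≤ eLpNorm u (ENNReal.ofReal p) P :=
    eLpNorm_le_eLpNorm_of_exponent_le (by simpa using hp) hu
  rw [eLpNorm_one_eq_lintegral_enorm, eLpNorm_eq_lintegral_rpow_enorm_toReal (by simpa using hp0)
    ENNReal.ofReal_ne_top, ENNReal.toReal_ofReal hp0.le, one_div] at hnorm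
  exact (ENNReal.le_rpow_inv_iff hp0).1 ((enorm_integral_le_lintegral_enorm u).trans hnorm)

theorem tendsto_eLpNorm_sub_of_dominated {α : Type*} [MeasurableSpace α] {ν : Measure α}
    {p : ℝ} (hp : 0 < p) {F : ℕ → α → ℝ} {f G : α → ℝ}
    (hG : MemLp G (ENNReal.ofReal p) ν) (hF : ∀ n, AEStronglyMeasurable (F n) ν)
    (hf : AEStronglyMeasurable f ν) (hFG : ∀ᶠ n in atTop, ∀ᵐ x ∂ν, |F n x - f x| ≤ G x)
    (hlim : ∀ᵐ x ∂ν, Tendsto (fun n => F n x) atTop (𝓝 (f x))) :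
    Tendsto (fun n => eLpNorm (F n - f) (ENNReal.ofReal p) ν) atTop (𝓝 0) := by
  have hp' : ENNReal.ofReal p ≠ 0 := by simpa using hp
  have hint : Tendsto (fun n => ∫⁻ x, ‖(F n - f) x‖ₑ ^ p ∂ν) atTop (𝓝 (∫⁻ _, 0 ∂ν)) := by
    refine tendsto_lintegral_filter_of_dominated_convergence' (fun x => ‖G x‖ₑ ^ p)
      (.of_forall fun n => ((hF n).sub hf).enorm.pow_const p) (hFG.mono fun n hn => ?_) ?_ ?_
    · filter_upwards [hn] with x hx
      gcongr
      exact enorm_le_iff_norm_le.2 <| hx.trans (le_abs_self _)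
    · have := lintegral_rpow_enorm_lt_top_of_eLpNorm_lt_top hp' ENNReal.ofReal_ne_top hG.2
      rw [ENNReal.toReal_ofReal hp.le] at this
      exact this.ne
    · filter_upwards [hlim] with x hx
      have := ((hx.sub_const (f x)).enorm).ennrpow_const p
      simpa [hp] using this
  simp only [eLpNorm_eq_lintegral_rpow_enorm_toReal hp' ENNReal.ofReal_ne_top,
    ENNReal.toReal_ofReal hp.le]
  have := hint.ennrpow_const (1 / p)
  simpa [hp] using this

section OperatorBound

variable {E : Type*} [NormedAddCommGroup E] [NormedSpace ℝ E] [HasContDiffBump E]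
  [MeasurableSpace E] [BorelSpace E] [FiniteDimensional ℝ E] {μ : Measure E}
  [μ.IsAddHaarMeasure] {b : ContDiffBump (0 : E)} {u : E → ℝ}

theorem enorm_mollify_rpow_le (hu : AEStronglyMeasurable u μ) {p : ℝ} (hp : 1 ≤ p) (x : E) :
    ‖mollify μ b u x‖ₑ ^ p ≤ ∫⁻ y, ENNReal.ofReal (b.normed μ (x - y)) * ‖u y‖ₑ ^ p ∂μ := by
  have hb := b.continuous_normed (μ := μ)
  have hdens : Measurable fun y => ENNReal.ofReal (b.normed μ (x - y)) :=
    (Continuous.measurable (by fun_prop)).ennreal_ofReal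
  have : IsProbabilityMeasure (μ.withDensity fun y => ENNReal.ofReal (b.normed μ (x - y))) := by
    refine ⟨?_⟩
    rw [withDensity_apply _ MeasurableSet.univ, Measure.restrict_univ,
      lintegral_sub_left_eq_self (fun y => ENNReal.ofReal (b.normed μ y)),
      ← ofReal_integral_eq_lintegral_ofReal b.integrable_normed (.of_forall b.nonneg_normed),
      b.integral_normed, ENNReal.ofReal_one]
  have hmean : mollify μ b u x =
      ∫ y, u y ∂μ.withDensity fun y => ENNReal.ofReal (b.normed μ (x - y)) := by
    rw [integral_withDensity_eq_integral_toReal_smul₀ hdens.aemeasurable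
      (.of_forall fun _ => ENNReal.ofReal_lt_top), mollify_apply_eq_integral_sub_mul]
    simp only [ENNReal.toReal_ofReal (b.nonneg_normed _), smul_eq_mul]
  rw [hmean]
  refine (enorm_integral_rpow_le (hu.mono_ac (withDensity_absolutelyContinuous _ _))
    hp).trans_eq ?_
  exact lintegral_withDensity_eq_lintegral_mul₀ hdens.aemeasurable (hu.enorm.pow_const p)

theorem lintegral_mul_enorm_mollify_rpow_le {W : E → ENNReal} {A : ENNReal}
    (hW : AEMeasurable W μ)
    (hA : ∀ᵐ y ∂μ, ∫⁻ x, ENNReal.ofReal (b.normed μ (x - y)) * W x ∂μ ≤ A * W y)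
    (hu : AEStronglyMeasurable u μ) {p : ℝ} (hp : 1 ≤ p) :
    ∫⁻ x, W x * ‖mollify μ b u x‖ₑ ^ p ∂μ ≤ A * ∫⁻ y, W y * ‖u y‖ₑ ^ p ∂μ := by
  have hb := b.continuous_normed (μ := μ)
  have hbm : Measurable fun z : E × E => ENNReal.ofReal (b.normed μ (z.1 - z.2)) :=
    (Continuous.measurable (by fun_prop)).ennreal_ofReal
  have hup : AEMeasurable (fun y => ‖u y‖ₑ ^ p) μ := hu.enorm.pow_const p
  have hslice (x : E) :
      AEMeasurable (fun y => ENNReal.ofReal (b.normed μ (x - y)) * ‖u y‖ₑ ^ p) μ :=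
    (hbm.comp measurable_prodMk_left).aemeasurable.mul hup
  have hslice' (y : E) : AEMeasurable (fun x => ENNReal.ofReal (b.normed μ (x - y)) * W x) μ :=
    (hbm.comp measurable_prodMk_right).aemeasurable.mul hW
  calc ∫⁻ x, W x * ‖mollify μ b u x‖ₑ ^ p ∂μ
      ≤ ∫⁻ x, ∫⁻ y, W x * (ENNReal.ofReal (b.normed μ (x - y)) * ‖u y‖ₑ ^ p) ∂μ ∂μ := by
        refine lintegral_mono fun x => ?_
        simp only
        rw [lintegral_const_mul'' _ (hslice x)]
        gcongr
        exact enorm_mollify_rpow_le hu hp x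
    _ = ∫⁻ y, ∫⁻ x, W x * (ENNReal.ofReal (b.normed μ (x - y)) * ‖u y‖ₑ ^ p) ∂μ ∂μ :=
        lintegral_lintegral_swap (hW.comp_fst.mul (hbm.aemeasurable.mul hup.comp_snd))
    _ = ∫⁻ y, (∫⁻ x, ENNReal.ofReal (b.normed μ (x - y)) * W x ∂μ) * ‖u y‖ₑ ^ p ∂μ := by
        congr with y
        rw [← lintegral_mul_const'' _ (hslice' y)]
        congr with x
        rw [mul_left_comm, mul_assoc]
    _ ≤ ∫⁻ y, A * (W y * ‖u y‖ₑ ^ p) ∂μ := by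
        refine lintegral_mono_ae (hA.mono fun y hy => ?_)
        rw [← mul_assoc]
        gcongr
    _ = A * ∫⁻ y, W y * ‖u y‖ₑ ^ p ∂μ := lintegral_const_mul'' _ (hW.mul hup)

end OperatorBound

theorem tendsto_lintegral_enorm_mul_sub {α : Type*} [MeasurableSpace α] {ν : Measure α}
    {p q : ENNReal} [p.HolderConjugate q] {f u : α → ℝ} {U : ℕ → α → ℝ} (hf : MemLp f q ν)
    (hu : MemLp u p ν) (hU : ∀ n, MemLp (U n) p ν)
    (hlim : Tendsto (fun n => eLpNorm (U n - u) p ν) atTop (𝓝 0)) :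
    Tendsto (fun n => ∫⁻ x, ‖f x * (U n x - u x)‖ₑ ∂ν) atTop (𝓝 0) := by
  have : q.HolderConjugate p := ENNReal.HolderConjugate.symm
  have hbound : Tendsto (fun n => eLpNorm f q ν * eLpNorm (U n - u) p ν) atTop (𝓝 0) := by
    simpa using ENNReal.Tendsto.const_mul hlim (.inr hf.2.ne)
  refine tendsto_of_tendsto_of_tendsto_of_le_of_le tendsto_const_nhds hbound
    (fun n => zero_le) (fun n => ?_)
  have := eLpNorm_smul_le_mul_eLpNorm (p := q) (q := p) (r := 1) ((hU n).sub hu).1 hf.1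
  rwa [eLpNorm_one_eq_lintegral_enorm] at this

theorem tendsto_integral_mul_of_tendsto_eLpNorm {α : Type*} [MeasurableSpace α] {ν : Measure α}
    {p q : ENNReal} [p.HolderConjugate q] {f u : α → ℝ} {U : ℕ → α → ℝ} (hf : MemLp f q ν)
    (hu : MemLp u p ν) (hU : ∀ n, MemLp (U n) p ν)
    (hlim : Tendsto (fun n => eLpNorm (U n - u) p ν) atTop (𝓝 0)) :
    Tendsto (fun n => ∫ x, f x * U n x ∂ν) atTop (𝓝 (∫ x, f x * u x ∂ν)) := by
  have : q.HolderConjugate p := ENNReal.HolderConjugate.symm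
  refine tendsto_integral_of_L1 (fun x => f x * u x) (hf.1.mul hu.1)
    (.of_forall fun n => hf.integrable_mul (hU n)) ?_
  simpa only [mul_sub] using tendsto_lintegral_enorm_mul_sub hf hu hU hlim

/-- The measure `ρ(x) dx` whose Lebesgue spaces are the spaces `L^p_ρ`. -/
abbrev weightMeasure (ρ : Rd d → ℝ) : Measure (Rd d) :=
  volume.withDensity fun x => ENNReal.ofReal (ρ x)

/-- Muckenhoupt weights of class `A₁` that decay no faster than `|x|^(-γ)`. The averages in the
`A₁` condition are taken against the bump functions that are used for mollification; the ratio of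
the radii of a bump function is fixed, which makes these averages comparable to those over
balls. -/
structure IsA1Weight (ρ : Rd d → ℝ) (γ : ℝ) : Prop where
  aemeasurable : AEMeasurable ρ volume
  lower : ∃ c, 0 < c ∧ ∀ᵐ x : Rd d, c * (1 + ‖x‖) ^ (-γ) ≤ ρ x
  average_le : ∃ A : ENNReal, A ≠ ⊤ ∧ ∀ b : ContDiffBump (0 : Rd d), b.rOut = 2 * b.rIn →
    ∀ᵐ y : Rd d, ∫⁻ x, ENNReal.ofReal (b.normed volume (x - y)) * ENNReal.ofReal (ρ x) ≤
      A * ENNReal.ofReal (ρ y)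

namespace IsA1Weight

variable {ρ : Rd d → ℝ} {γ p : ℝ} {f u : Rd d → ℝ} {U : ℕ → Rd d → ℝ}

theorem ae_pos (hρ : IsA1Weight ρ γ) : ∀ᵐ x, 0 < ρ x := by
  obtain ⟨c, hc, hlower⟩ := hρ.lower
  filter_upwards [hlower] with x hx
  exact lt_of_lt_of_le (by positivity) hx

theorem absolutelyContinuous (hρ : IsA1Weight ρ γ) : volume ≪ weightMeasure ρ :=
  withDensity_absolutelyContinuous' hρ.aemeasurable.ennreal_ofReal <| by
    filter_upwards [hρ.ae_pos] with x hx
    simpa using hx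

theorem aestronglyMeasurable (hρ : IsA1Weight ρ γ) (hu : MemLpWeight p ρ u) :
    AEStronglyMeasurable u :=
  hu.aestronglyMeasurable.mono_ac hρ.absolutelyContinuous

theorem isLocallyFiniteMeasure (hρ : IsA1Weight ρ γ) :
    IsLocallyFiniteMeasure (weightMeasure ρ) := by
  refine ⟨fun x₀ => ⟨Metric.ball x₀ 1, Metric.ball_mem_nhds x₀ one_pos, ?_⟩⟩
  obtain ⟨A, hA, havg⟩ := hρ.average_le
  let b : ContDiffBump (0 : Rd d) := ⟨2, 4, by norm_num, by norm_num⟩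
  obtain ⟨y, hy, hxy⟩ : ∃ y, ∫⁻ x, ENNReal.ofReal (b.normed volume (x - y)) *
      ENNReal.ofReal (ρ x) ≤ A * ENNReal.ofReal (ρ y) ∧ y ∈ Metric.ball x₀ 1 :=
    ((Measure.dense_of_ae (havg b (by norm_num [b]))).inter_open_nonempty _ Metric.isOpen_ball
      (Metric.nonempty_ball.2 one_pos)).imp fun y hy => ⟨hy.2, hy.1⟩
  have hb (x) (hx : x ∈ Metric.ball x₀ 1) : b.normed volume (x - y) = (∫ z, b z)⁻¹ := by
    rw [ContDiffBump.normed_def, b.one_of_mem_closedBall, one_div]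
    rw [mem_closedBall_zero_iff, ← dist_eq_norm]
    have := dist_triangle_right x y x₀
    rw [Metric.mem_ball] at hx hxy
    exact (this.trans_lt (by linarith : _ < (2 : ℝ))).le
  have hb0 : ENNReal.ofReal (∫ z, b z)⁻¹ ≠ 0 := by simpa using b.integral_pos
  have hle : ENNReal.ofReal (∫ z, b z)⁻¹ * weightMeasure ρ (Metric.ball x₀ 1) ≤
      A * ENNReal.ofReal (ρ y) := by
    rw [withDensity_apply _ Metric.isOpen_ball.measurableSet,
      ← lintegral_const_mul'' _ hρ.aemeasurable.ennreal_ofReal.restrict]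
    refine le_trans ?_ ((setLIntegral_le_lintegral (Metric.ball x₀ 1) _).trans hy)
    exact setLIntegral_mono' Metric.isOpen_ball.measurableSet fun x hx => by rw [hb x hx]
  exact ENNReal.lt_top_of_mul_ne_top_right
    (hle.trans_lt (ENNReal.mul_lt_top hA.lt_top ENNReal.ofReal_lt_top)).ne hb0

theorem lintegral_enorm_inv_mul (hρ : IsA1Weight ρ γ) (f : Rd d → ℝ) :
    ∫⁻ x, ‖(ρ x)⁻¹ * f x‖ₑ ∂weightMeasure ρ = ∫⁻ x, ‖f x‖ₑ := by
  rw [lintegral_withDensity_eq_lintegral_mul_non_measurable₀ _ hρ.aemeasurable.ennreal_ofReal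
    (.of_forall fun _ => ENNReal.ofReal_lt_top)]
  refine lintegral_congr_ae ?_
  filter_upwards [hρ.ae_pos] with x hx
  rw [Pi.mul_apply, ← Real.enorm_of_nonneg hx.le, ← enorm_mul, mul_inv_cancel_left₀ hx.ne']

theorem toReal_smul_inv_mul_ae_eq (hρ : IsA1Weight ρ γ) (f : Rd d → ℝ) :
    (fun x => (ENNReal.ofReal (ρ x)).toReal • ((ρ x)⁻¹ * f x)) =ᵐ[volume] f := by
  filter_upwards [hρ.ae_pos] with x hx
  rw [ENNReal.toReal_ofReal hx.le, smul_eq_mul, mul_inv_cancel_left₀ hx.ne']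

theorem integrable_inv_mul_iff (hρ : IsA1Weight ρ γ) :
    Integrable (fun x => (ρ x)⁻¹ * f x) (weightMeasure ρ) ↔ Integrable f := by
  rw [integrable_withDensity_iff_integrable_smul₀' hρ.aemeasurable.ennreal_ofReal
    (.of_forall fun _ => ENNReal.ofReal_lt_top)]
  exact integrable_congr (hρ.toReal_smul_inv_mul_ae_eq f)

theorem integral_inv_mul (hρ : IsA1Weight ρ γ) (f : Rd d → ℝ) :
    ∫ x, (ρ x)⁻¹ * f x ∂weightMeasure ρ = ∫ x, f x := by
  rw [integral_withDensity_eq_integral_toReal_smul₀ hρ.aemeasurable.ennreal_ofReal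
    (.of_forall fun _ => ENNReal.ofReal_lt_top)]
  exact integral_congr_ae (hρ.toReal_smul_inv_mul_ae_eq f)

theorem memLpWeight_inv_mul_indicator (hρ : IsA1Weight ρ γ) (q : ℝ) {K : Set (Rd d)}
    (hK : IsCompact K) : MemLpWeight q ρ fun x => (ρ x)⁻¹ * K.indicator 1 x := by
  have := hρ.isLocallyFiniteMeasure
  obtain ⟨c, hc, hlower⟩ := hρ.lower
  obtain ⟨M, hM⟩ := hK.exists_bound_of_continuousOn
    (f := fun x => (c * (1 + ‖x‖) ^ (-γ))⁻¹)
    ((continuous_const.mul (continuous_one_add_norm_rpow (-γ))).inv₀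
      fun x => (mul_pos hc (Real.rpow_pos_of_pos (by positivity) _)).ne').continuousOn
  have hbound : MemLp (K.indicator fun _ => M) (ENNReal.ofReal q) (weightMeasure ρ) :=
    memLp_indicator_const _ hK.measurableSet M (.inr hK.measure_lt_top.ne)
  have hmeas : AEStronglyMeasurable fun x => (ρ x)⁻¹ * K.indicator (1 : Rd d → ℝ) x :=
    hρ.aemeasurable.inv.aestronglyMeasurable.mul
      ((measurable_one.indicator hK.measurableSet).aestronglyMeasurable)
  refine hbound.mono (hmeas.mono_ac (withDensity_absolutelyContinuous _ _)) ?_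
  filter_upwards [(withDensity_absolutelyContinuous _ _).ae_le hlower] with x hx
  by_cases hxK : x ∈ K
  · have hMx := hM x hxK
    have hpos : 0 < c * (1 + ‖x‖) ^ (-γ) := by positivity
    simp only [hxK, Set.indicator_of_mem, Pi.one_apply, mul_one, Real.norm_eq_abs] at hMx ⊢
    rw [abs_of_pos (inv_pos.2 hpos)] at hMx
    rw [abs_of_nonneg (inv_nonneg.2 (hpos.le.trans hx))]
    exact (inv_anti₀ hpos hx).trans (hMx.trans (le_abs_self M))
  · simp only [hxK, not_false_eq_true, Set.indicator_of_notMem, mul_zero, le_refl]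

section Duality

variable (hρ : IsA1Weight ρ γ) (hpq : p.HolderConjugate q)

include hρ hpq

theorem integrable_mul (hf : MemLpWeight q ρ fun x => (ρ x)⁻¹ * f x) (hu : MemLpWeight p ρ u) :
    Integrable fun x => f x * u x := by
  have := hpq.symm.ennrealOfReal
  rw [← hρ.integrable_inv_mul_iff]
  simpa only [← mul_assoc] using! MemLp.integrable_mul hf hu

theorem tendsto_integral_mul (hf : MemLpWeight q ρ fun x => (ρ x)⁻¹ * f x)
    (hu : MemLpWeight p ρ u) (hU : ∀ n, MemLpWeight p ρ (U n))
    (hlim : Tendsto (fun n => eLpNorm (U n - u) (ENNReal.ofReal p) (weightMeasure ρ))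
      atTop (𝓝 0)) :
    Tendsto (fun n => ∫ x, f x * U n x) atTop (𝓝 (∫ x, f x * u x)) := by
  have := hpq.ennrealOfReal
  simpa only [mul_assoc, hρ.integral_inv_mul] using
    tendsto_integral_mul_of_tendsto_eLpNorm hf hu hU hlim

theorem locallyIntegrable (hu : MemLpWeight p ρ u) : LocallyIntegrable u := by
  refine locallyIntegrable_iff.2 fun K hK => ?_
  rw [← integrable_indicator_iff hK.measurableSet]
  refine (hρ.integrable_mul hpq (hρ.memLpWeight_inv_mul_indicator q hK) hu).congr
    (.of_forall fun x => ?_)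
  by_cases hx : x ∈ K <;> simp [hx]

theorem locallyIntegrable_of_inv_mul (hf : MemLpWeight q ρ fun x => (ρ x)⁻¹ * f x) :
    LocallyIntegrable f := by
  have := hρ.isLocallyFiniteMeasure
  refine locallyIntegrable_iff.2 fun K hK => ?_
  have hind : MemLpWeight p ρ (K.indicator fun _ => 1) :=
    memLp_indicator_const _ hK.measurableSet 1 (.inr hK.measure_lt_top.ne)
  rw [← integrable_indicator_iff hK.measurableSet]
  refine (hρ.integrable_mul hpq hf hind).congr (.of_forall fun x => ?_)
  by_cases hx : x ∈ K <;> simp [hx]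

theorem tendsto_setLIntegral_enorm_sub (hu : MemLpWeight p ρ u) (hU : ∀ n, MemLpWeight p ρ (U n))
    (hlim : Tendsto (fun n => eLpNorm (U n - u) (ENNReal.ofReal p) (weightMeasure ρ))
      atTop (𝓝 0)) {K : Set (Rd d)} (hK : IsCompact K) :
    Tendsto (fun n => ∫⁻ x in K, ‖u x - U n x‖ₑ) atTop (𝓝 0) := by
  have := hpq.ennrealOfReal
  have hconv := tendsto_lintegral_enorm_mul_sub (hρ.memLpWeight_inv_mul_indicator q hK) hu hU hlim
  simp only [mul_assoc, hρ.lintegral_enorm_inv_mul] at hconv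
  refine hconv.congr fun n => ?_
  rw [← lintegral_indicator hK.measurableSet]
  congr with x
  by_cases hx : x ∈ K <;> simp [hx, enorm_sub_rev]

end Duality

/-! ### Convergence of mollifications in `L^p_ρ` -/

theorem exists_eLpNorm_mollify_le (hρ : IsA1Weight ρ γ) (hp : 1 ≤ p) :
    ∃ A : ENNReal, A ≠ ⊤ ∧ ∀ b : ContDiffBump (0 : Rd d), b.rOut = 2 * b.rIn →
      ∀ u : Rd d → ℝ, MemLpWeight p ρ u →
        eLpNorm (mollify volume b u) (ENNReal.ofReal p) (weightMeasure ρ) ≤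
          A * eLpNorm u (ENNReal.ofReal p) (weightMeasure ρ) := by
  obtain ⟨A, hA, havg⟩ := hρ.average_le
  have hp0 : 0 < p := one_pos.trans_le hp
  refine ⟨A ^ (1 / p), ENNReal.rpow_ne_top_of_nonneg (by positivity) hA, fun b hb u hu => ?_⟩
  have hrpow := lintegral_mul_enorm_mollify_rpow_le hρ.aemeasurable.ennreal_ofReal (havg b hb)
    (hρ.aestronglyMeasurable hu) hp
  simp only [eLpNorm_eq_lintegral_rpow_enorm_toReal (ENNReal.ofReal_pos.2 hp0).ne'
    ENNReal.ofReal_ne_top, ENNReal.toReal_ofReal hp0.le,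
    lintegral_withDensity_eq_lintegral_mul_non_measurable₀ volume hρ.aemeasurable.ennreal_ofReal
      (.of_forall fun _ => ENNReal.ofReal_lt_top)]
  rw [← ENNReal.mul_rpow_of_nonneg _ _ (by positivity)]
  exact ENNReal.rpow_le_rpow hrpow (by positivity)

theorem memLpWeight_of_continuous (hρ : IsA1Weight ρ γ) (p : ℝ) (hu : Continuous u)
    (hc : HasCompactSupport u) : MemLpWeight p ρ u := by
  have := hρ.isLocallyFiniteMeasure
  exact hu.memLp_of_hasCompactSupport hc

theorem memLpWeight_mollify (hρ : IsA1Weight ρ γ) (hp : 1 < p) (hu : MemLpWeight p ρ u)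
    {b : ContDiffBump (0 : Rd d)} (hb : b.rOut = 2 * b.rIn) :
    MemLpWeight p ρ (mollify volume b u) := by
  obtain ⟨A, hA, hle⟩ := hρ.exists_eLpNorm_mollify_le hp.le
  have hloc := hρ.locallyIntegrable (.conjExponent hp) hu
  exact ⟨(contDiff_mollify b hloc).continuous.aestronglyMeasurable,
    (hle b hb u hu).trans_lt (ENNReal.mul_lt_top hA.lt_top hu.2)⟩

variable {b : ℕ → ContDiffBump (0 : Rd d)}

theorem tendsto_eLpNorm_mollify_sub_of_continuous (hρ : IsA1Weight ρ γ) (hp : 0 < p)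
    {g : Rd d → ℝ} (hg : Continuous g) (hc : HasCompactSupport g)
    (hb0 : Tendsto (fun n => (b n).rOut) atTop (𝓝 0)) :
    Tendsto (fun n => eLpNorm (mollify volume (b n) g - g) (ENNReal.ofReal p) (weightMeasure ρ))
      atTop (𝓝 0) := by
  have := hρ.isLocallyFiniteMeasure
  obtain ⟨R, hR⟩ := hc.exists_pos_le_norm
  obtain ⟨M, hM⟩ := hc.exists_bound_of_continuous hg
  have hclose (n x) : |mollify volume (b n) g x - g x| ≤ 2 * M := by
    refine ContDiffBump.dist_normed_convolution_le hg.aestronglyMeasurable fun y _ => ?_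
    exact (dist_le_norm_add_norm _ _).trans (by linarith [hM y, hM x])
  refine tendsto_eLpNorm_sub_of_dominated hp
    (G := (Metric.closedBall 0 (R + 1)).indicator fun _ => 2 * M)
    (memLp_indicator_const _ Metric.isClosed_closedBall.measurableSet _
      (.inr (isCompact_closedBall _ _).measure_lt_top.ne))
    (fun n => (contDiff_mollify _ hg.locallyIntegrable).continuous.aestronglyMeasurable)
    hg.aestronglyMeasurable ?_
    (.of_forall fun x => ContDiffBump.convolution_tendsto_right_of_continuous hb0 hg x)
  filter_upwards [hb0.eventually_le_const one_pos] with n hn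
  refine .of_forall fun x => ?_
  by_cases hx : ‖x‖ ≤ R + 1
  · rw [Set.indicator_of_mem (mem_closedBall_zero_iff.2 hx)]
    exact hclose n x
  · rw [mollify_eq_zero (b n) hR.2 (by linarith), hR.2 x (by linarith), sub_self, abs_zero]
    exact Set.indicator_nonneg (fun _ _ => (abs_nonneg _).trans (hclose n x)) x

theorem tendsto_eLpNorm_mollify_sub (hρ : IsA1Weight ρ γ) (hp : 1 < p) (hu : MemLpWeight p ρ u)
    (hb : ∀ n, (b n).rOut = 2 * (b n).rIn) (hb0 : Tendsto (fun n => (b n).rOut) atTop (𝓝 0)) :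
    Tendsto (fun n => eLpNorm (mollify volume (b n) u - u) (ENNReal.ofReal p) (weightMeasure ρ))
      atTop (𝓝 0) := by
  have := hρ.isLocallyFiniteMeasure
  obtain ⟨A, hA, hle⟩ := hρ.exists_eLpNorm_mollify_le hp.le
  have hA1 : A + 1 ≠ ⊤ := by simpa using hA
  have hp' : 1 ≤ ENNReal.ofReal p := by simpa using hp.le
  rw [ENNReal.tendsto_nhds_zero]
  intro ε hε
  have hη : ε / 2 / (A + 1) ≠ 0 := by simp [hε.ne', hA1]
  obtain ⟨g, hgc, hgu, hg, hgm⟩ :=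
    hu.exists_hasCompactSupport_eLpNorm_sub_le ENNReal.ofReal_ne_top hη
  have hcont := hρ.tendsto_eLpNorm_mollify_sub_of_continuous (one_pos.trans hp) hg hgc hb0
  filter_upwards [ENNReal.tendsto_nhds_zero.1 hcont (ε / 2) (ENNReal.half_pos hε.ne')] with n hn
  have hug : MemLpWeight p ρ (u - g) := hu.sub hgm
  have hmug := hρ.memLpWeight_mollify hp hug (hb n)
  have hmg := hρ.memLpWeight_mollify hp hgm (hb n)
  have hsplit : mollify volume (b n) u - u =
      mollify volume (b n) (u - g) + (mollify volume (b n) g - g) - (u - g) := by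
    rw [mollify_sub (b n) (hρ.locallyIntegrable (.conjExponent hp) hu) hg.locallyIntegrable]
    abel
  rw [hsplit]
  calc eLpNorm (mollify volume (b n) (u - g) + (mollify volume (b n) g - g) - (u - g))
        (ENNReal.ofReal p) (weightMeasure ρ)
      ≤ A * (ε / 2 / (A + 1)) + ε / 2 + ε / 2 / (A + 1) := by
        refine (eLpNorm_sub_le (hmug.1.add (hmg.1.sub hgm.1)) hug.1 hp').trans ?_
        refine add_le_add ((eLpNorm_add_le hmug.1 (hmg.1.sub hgm.1) hp').trans ?_) hgu
        refine add_le_add ((hle (b n) (hb n) _ hug).trans ?_) hn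
        gcongr
    _ = (A + 1) * (ε / 2 / (A + 1)) + ε / 2 := by ring
    _ = ε := by rw [ENNReal.mul_div_cancel (by simp) hA1, ENNReal.add_halves]

theorem tendsto_eLpNorm_mollify_comp_sub (hρ : IsA1Weight ρ γ) (hp : 1 < p)
    (hu : MemLpWeight p ρ u) (hU : ∀ n, MemLpWeight p ρ (U n))
    (hlim : Tendsto (fun n => eLpNorm (U n - u) (ENNReal.ofReal p) (weightMeasure ρ))
      atTop (𝓝 0))
    (hb : ∀ n, (b n).rOut = 2 * (b n).rIn) (hb0 : Tendsto (fun n => (b n).rOut) atTop (𝓝 0)) :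
    Tendsto (fun n => eLpNorm (mollify volume (b n) (U n) - u) (ENNReal.ofReal p)
      (weightMeasure ρ)) atTop (𝓝 0) := by
  obtain ⟨A, hA, hle⟩ := hρ.exists_eLpNorm_mollify_le hp.le
  have hp' : 1 ≤ ENNReal.ofReal p := by simpa using hp.le
  have hloc {g} (hg : MemLpWeight p ρ g) := hρ.locallyIntegrable (.conjExponent hp) hg
  have hbound := (ENNReal.Tendsto.const_mul hlim (.inr hA)).add
    (hρ.tendsto_eLpNorm_mollify_sub hp hu hb hb0)
  rw [mul_zero, add_zero] at hbound
  refine tendsto_of_tendsto_of_tendsto_of_le_of_le tendsto_const_nhds hbound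
    (fun n => zero_le) fun n => ?_
  have hUu : MemLpWeight p ρ (U n - u) := (hU n).sub hu
  have hsplit : mollify volume (b n) (U n) - u =
      mollify volume (b n) (U n - u) + (mollify volume (b n) u - u) := by
    rw [mollify_sub (b n) (hloc (hU n)) (hloc hu)]
    abel
  rw [hsplit]
  exact (eLpNorm_add_le (hρ.memLpWeight_mollify hp hUu (hb n)).1
    ((hρ.memLpWeight_mollify hp hu (hb n)).1.sub hu.1) hp').trans
      (add_le_add_left (hle (b n) (hb n) _ hUu) _)

end IsA1Weight

/-! ### Embedding into `L²((1 + |x|)^(-σ) dx)` -/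

theorem sq_le_rpow_mul_rpow_add_sq {t m p : ℝ} (ht : 0 ≤ t) (hm : 0 < m) (hp : 2 ≤ p) :
    t ^ 2 ≤ t ^ p * m ^ (2 - p) + m ^ 2 := by
  rcases le_or_gt t m with h | h
  · have : 0 ≤ t ^ p * m ^ (2 - p) := by positivity
    linarith [pow_le_pow_left₀ ht h 2]
  · have ht' : 0 < t := hm.trans h
    calc t ^ 2 = t ^ p * t ^ (2 - p) := by
          rw [← Real.rpow_add ht', add_sub_cancel, Real.rpow_two]
      _ ≤ t ^ p * m ^ (2 - p) :=
          mul_le_mul_of_nonneg_left (Real.rpow_le_rpow_of_nonpos hm h.le (by linarith))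
            (by positivity)
      _ ≤ t ^ p * m ^ (2 - p) + m ^ 2 := le_add_of_nonneg_right (sq_nonneg m)

theorem exists_sq_mul_rpow_neg_le {p σ γ D : ℝ} (hp : 2 ≤ p) (h : p * (D - σ) < 2 * (D - γ)) :
    ∃ r, D < r ∧ ∀ t m : ℝ, 0 ≤ t → 1 ≤ m →
      t ^ 2 * m ^ (-σ) ≤ t ^ p * m ^ (-γ) + m ^ (-r) := by
  have hp1 : 0 < p - 1 := by linarith
  let e := D - γ - p * (D - σ) / 2
  have he : 0 < e := by simp only [e]; linarith
  let a := (D - σ) / 2 + e / (p - 1)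
  have hslack : e / (p - 1) * (p - 2) ≤ e := by
    rw [div_mul_eq_mul_div, div_le_iff₀ hp1]
    exact mul_le_mul_of_nonneg_left (by linarith) he.le
  have hexp : -a * (2 - p) - σ ≤ -γ := by
    have : a * (p - 2) = (D - σ) / 2 * (p - 2) + e / (p - 1) * (p - 2) := add_mul _ _ _
    simp only [e] at hslack this
    linarith
  refine ⟨2 * a + σ, ?_, fun t m ht hm => ?_⟩
  · have := div_pos he hp1
    simp only [a]
    linarith
  · have hm0 : 0 < m := one_pos.trans_le hm
    calc t ^ 2 * m ^ (-σ)
        ≤ (t ^ p * (m ^ (-a)) ^ (2 - p) + (m ^ (-a)) ^ 2) * m ^ (-σ) := by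
          gcongr
          exact sq_le_rpow_mul_rpow_add_sq ht (by positivity) hp
      _ = t ^ p * m ^ (-a * (2 - p) - σ) + m ^ (-(2 * a + σ)) := by
          rw [← Real.rpow_mul hm0.le, ← Real.rpow_two, ← Real.rpow_mul hm0.le, add_mul, mul_assoc,
            ← Real.rpow_add hm0, ← Real.rpow_add hm0]
          ring_nf
      _ ≤ t ^ p * m ^ (-γ) + m ^ (-(2 * a + σ)) := by
          gcongr

theorem IsA1Weight.integrable_mul_abs_rpow {ρ : Rd d → ℝ} {γ p : ℝ} (hρ : IsA1Weight ρ γ)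
    (hp : 0 < p) (hv : MemLpWeight p ρ v) : Integrable fun x => ρ x * |v x| ^ p := by
  have hint := hv.integrable_norm_rpow (by simpa using hp) ENNReal.ofReal_ne_top
  rw [ENNReal.toReal_ofReal hp.le] at hint
  refine hρ.integrable_inv_mul_iff.1 (hint.congr ?_)
  filter_upwards [(withDensity_absolutelyContinuous _ _).ae_le hρ.ae_pos] with x hx
  rw [inv_mul_cancel_left₀ hx.ne', Real.norm_eq_abs]

theorem IsA1Weight.integrable_sq_mul_rpow_neg {ρ : Rd d → ℝ} {γ σ p : ℝ} (hρ : IsA1Weight ρ γ)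
    (hp : 2 ≤ p) (hσ : p * (d - σ) < 2 * (d - γ)) (hv : MemLpWeight p ρ v) :
    Integrable fun x => v x ^ 2 * (1 + ‖x‖) ^ (-σ) := by
  obtain ⟨c, hc, hlower⟩ := hρ.lower
  obtain ⟨r, hr, hle⟩ := exists_sq_mul_rpow_neg_le hp hσ
  have hdecay : Integrable fun x : Rd d => (1 + ‖x‖) ^ (-r) :=
    integrable_one_add_norm (by rwa [finrank_euclideanSpace_fin])
  refine (((hρ.integrable_mul_abs_rpow (by linarith) hv).const_mul c⁻¹).add hdecay).mono'
    (((hρ.aestronglyMeasurable hv).pow 2).mul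
      (continuous_one_add_norm_rpow _).aestronglyMeasurable) ?_
  filter_upwards [hlower] with x hx
  rw [Real.norm_of_nonneg (by positivity), ← sq_abs]
  refine (hle _ _ (abs_nonneg (v x)) (le_add_of_nonneg_right (norm_nonneg x))).trans ?_
  have hρx : (1 + ‖x‖) ^ (-γ) ≤ c⁻¹ * ρ x := by rwa [inv_mul_eq_div, le_div_iff₀' hc]
  calc |v x| ^ p * (1 + ‖x‖) ^ (-γ) + (1 + ‖x‖) ^ (-r)
      ≤ |v x| ^ p * (c⁻¹ * ρ x) + (1 + ‖x‖) ^ (-r) := by gcongr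
    _ = c⁻¹ * (ρ x * |v x| ^ p) + (1 + ‖x‖) ^ (-r) := by ring

theorem MemL1Decay.of_integrable_sq {σ : ℝ} (hσ : 0 < σ) (hvm : AEStronglyMeasurable v)
    (hv : Integrable fun x => v x ^ 2 * (1 + ‖x‖) ^ (-σ)) : MemL1Decay (d + σ) v := by
  have hdecay : Integrable fun x : Rd d => (1 + ‖x‖) ^ (-((d : ℝ) + σ)) :=
    integrable_one_add_norm (by rw [finrank_euclideanSpace_fin]; linarith)
  refine (hv.add hdecay).mono'
    (hvm.mul (continuous_one_add_norm_rpow _).aestronglyMeasurable) (.of_forall fun x => ?_)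
  have hm : 1 ≤ 1 + ‖x‖ := le_add_of_nonneg_right (norm_nonneg x)
  have hv1 : |v x| ≤ v x ^ 2 + 1 := by nlinarith [sq_nonneg (|v x| - 1), sq_abs (v x)]
  rw [norm_mul, Real.norm_eq_abs, Real.norm_of_nonneg (by positivity)]
  calc |v x| * (1 + ‖x‖) ^ (-((d : ℝ) + σ))
      ≤ (v x ^ 2 + 1) * (1 + ‖x‖) ^ (-((d : ℝ) + σ)) := by gcongr
    _ = v x ^ 2 * (1 + ‖x‖) ^ (-((d : ℝ) + σ)) + (1 + ‖x‖) ^ (-((d : ℝ) + σ)) := by ring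
    _ ≤ v x ^ 2 * (1 + ‖x‖) ^ (-σ) + (1 + ‖x‖) ^ (-((d : ℝ) + σ)) := by
        gcongr
        linarith [d.cast_nonneg (α := ℝ)]

/-! ### Power weights -/

section PowerWeight

open Module

variable {E : Type*} [NormedAddCommGroup E] [NormedSpace ℝ E] [FiniteDimensional ℝ E]
  [MeasurableSpace E] [BorelSpace E] {μ : Measure E} [μ.IsAddHaarMeasure] {a : ℝ}

theorem setIntegral_closedBall_norm_rpow_neg {r : ℝ} (hr : 0 < r) :
    ∫ x in Metric.closedBall (0 : E) r, ‖x‖ ^ (-a) ∂μ =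
      r ^ finrank ℝ E * r ^ (-a) * ∫ x in Metric.closedBall (0 : E) 1, ‖x‖ ^ (-a) ∂μ := by
  have hscale := Measure.setIntegral_comp_smul_of_pos μ (fun x : E => ‖x‖ ^ (-a))
    (Metric.closedBall 0 1) hr
  simp only [smul_unitClosedBall_of_nonneg hr.le, norm_smul, Real.norm_of_nonneg hr.le, smul_eq_mul,
    Real.mul_rpow hr.le (norm_nonneg _), integral_const_mul] at hscale
  rw [mul_assoc, hscale, mul_inv_cancel_left₀ (by positivity)]

variable [HasContDiffBump E]

theorem lintegral_normed_sub (b : ContDiffBump (0 : E)) (y : E) :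
    ∫⁻ x, ENNReal.ofReal (b.normed μ (x - y)) ∂μ = 1 := by
  rw [lintegral_sub_right_eq_self (fun x => ENNReal.ofReal (b.normed μ x)) y,
    ← ofReal_integral_eq_lintegral_ofReal b.integrable_normed (.of_forall b.nonneg_normed),
    b.integral_normed, ENNReal.ofReal_one]

theorem lintegral_normed_mul_norm_rpow_neg_le_of_far (ha : 0 ≤ a) {b : ContDiffBump (0 : E)}
    {y : E} (hy : 2 * b.rOut ≤ ‖y‖) :
    ∫⁻ x, ENNReal.ofReal (b.normed μ (x - y)) * ENNReal.ofReal (‖x‖ ^ (-a)) ∂μ ≤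
      ENNReal.ofReal (2 ^ a) * ENNReal.ofReal (‖y‖ ^ (-a)) := by
  have hb : Measurable (b.normed μ) := b.continuous_normed.measurable
  have hy0 : 0 < ‖y‖ := by linarith [b.rOut_pos]
  have hpt (x : E) : ENNReal.ofReal (b.normed μ (x - y)) * ENNReal.ofReal (‖x‖ ^ (-a)) ≤
      ENNReal.ofReal (b.normed μ (x - y)) * ENNReal.ofReal (2 ^ a * ‖y‖ ^ (-a)) := by
    rcases le_or_gt b.rOut ‖x - y‖ with hx | hx
    · rw [normed_eq_zero b hx, ENNReal.ofReal_zero, zero_mul, zero_mul]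
    · have hxy : ‖y‖ / 2 ≤ ‖x‖ := by linarith [norm_sub_norm_le y x, norm_sub_rev x y]
      have : ‖x‖ ^ (-a) ≤ 2 ^ a * ‖y‖ ^ (-a) := calc
        ‖x‖ ^ (-a) ≤ (‖y‖ / 2) ^ (-a) :=
          Real.rpow_le_rpow_of_nonpos (by positivity) hxy (neg_nonpos.2 ha)
        _ = 2 ^ a * ‖y‖ ^ (-a) := by
          rw [Real.div_rpow hy0.le zero_le_two, Real.rpow_neg zero_le_two, div_inv_eq_mul,
            mul_comm]
      gcongr
  refine (lintegral_mono hpt).trans_eq ?_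
  rw [lintegral_mul_const _ (Measurable.ennreal_ofReal (by fun_prop)), lintegral_normed_sub,
    one_mul, ENNReal.ofReal_mul (by positivity)]

theorem lintegral_normed_mul_norm_rpow_neg_le_of_near (ha0 : 0 ≤ a) (ha : a < finrank ℝ E)
    {b : ContDiffBump (0 : E)} (hb : b.rOut = 2 * b.rIn) {y : E} (hy0 : y ≠ 0)
    (hy : ‖y‖ < 2 * b.rOut) :
    ∫⁻ x, ENNReal.ofReal (b.normed μ (x - y)) * ENNReal.ofReal (‖x‖ ^ (-a)) ∂μ ≤
      ENNReal.ofReal (6 ^ finrank ℝ E / μ.real (Metric.ball 0 1) *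
        ∫ x in Metric.closedBall (0 : E) 1, ‖x‖ ^ (-a) ∂μ) * ENNReal.ofReal (‖y‖ ^ (-a)) := by
  have hδ := b.rIn_pos
  have hpt (x : E) : ENNReal.ofReal (b.normed μ (x - y)) * ENNReal.ofReal (‖x‖ ^ (-a)) ≤
      (Metric.closedBall (0 : E) (6 * b.rIn)).indicator (fun x => ENNReal.ofReal
        (1 / (b.rIn ^ finrank ℝ E * μ.real (Metric.ball 0 1)) * ‖x‖ ^ (-a))) x := by
    rcases le_or_gt b.rOut ‖x - y‖ with hx | hx
    · rw [normed_eq_zero b hx, ENNReal.ofReal_zero, zero_mul]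
      exact zero_le
    · rw [Set.indicator_of_mem, ENNReal.ofReal_mul (by positivity)]
      · gcongr
        simpa only [Measure.addHaar_real_closedBall _ _ hδ.le] using
          b.normed_le_div_measure_closedBall_rIn μ (x - y)
      · rw [mem_closedBall_zero_iff]
        linarith [norm_sub_norm_le x y]
  have : 0 ≤ ∫ x in Metric.closedBall (0 : E) 1, ‖x‖ ^ (-a) ∂μ :=
    integral_nonneg fun x => by positivity
  refine (lintegral_mono hpt).trans ?_
  rw [lintegral_indicator Metric.isClosed_closedBall.measurableSet,
    ← ofReal_integral_eq_lintegral_ofReal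
      (((locallyIntegrable_norm_rpow_neg ha).integrableOn_isCompact
        (isCompact_closedBall _ _)).const_mul _) (.of_forall fun x => by positivity),
    ← ENNReal.ofReal_mul (by positivity), integral_const_mul,
    setIntegral_closedBall_norm_rpow_neg (by positivity), mul_pow]
  refine ENNReal.ofReal_le_ofReal ?_
  have hrpow : (6 * b.rIn) ^ (-a) ≤ ‖y‖ ^ (-a) :=
    Real.rpow_le_rpow_of_nonpos (norm_pos_iff.2 hy0) (by linarith) (neg_nonpos.2 ha0)
  calc _ = 6 ^ finrank ℝ E / μ.real (Metric.ball 0 1) *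
        (∫ x in Metric.closedBall (0 : E) 1, ‖x‖ ^ (-a) ∂μ) * (6 * b.rIn) ^ (-a) := by field_simp
    _ ≤ _ := by gcongr

theorem exists_lintegral_normed_mul_norm_rpow_neg_le (ha0 : 0 ≤ a) (ha : a < finrank ℝ E) :
    ∃ A : ENNReal, A ≠ ⊤ ∧ ∀ b : ContDiffBump (0 : E), b.rOut = 2 * b.rIn → ∀ y : E, y ≠ 0 →
      ∫⁻ x, ENNReal.ofReal (b.normed μ (x - y)) * ENNReal.ofReal (‖x‖ ^ (-a)) ∂μ ≤
        A * ENNReal.ofReal (‖y‖ ^ (-a)) := by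
  refine ⟨max (ENNReal.ofReal (2 ^ a)) (ENNReal.ofReal (6 ^ finrank ℝ E /
    μ.real (Metric.ball 0 1) * ∫ x in Metric.closedBall (0 : E) 1, ‖x‖ ^ (-a) ∂μ)),
    max_ne_top ENNReal.ofReal_ne_top ENNReal.ofReal_ne_top, fun b hb y hy0 => ?_⟩
  rcases le_or_gt (2 * b.rOut) ‖y‖ with hy | hy
  · refine (lintegral_normed_mul_norm_rpow_neg_le_of_far ha0 hy).trans ?_
    gcongr
    exact le_max_left _ _
  · refine (lintegral_normed_mul_norm_rpow_neg_le_of_near ha0 ha hb hy0 hy).trans ?_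
    gcongr
    exact le_max_right _ _

end PowerWeight

namespace IsWeight

variable {ρ : Rd d → ℝ} {γ₀ γ c C : ℝ}

theorem ae_bounds (hρ : IsWeight ρ γ₀ γ c C) (hd : 0 < d) (h01 : γ₀ ≤ γ) :
    ∀ᵐ x, c * min (‖x‖ ^ (-γ₀)) (‖x‖ ^ (-γ)) ≤ ρ x ∧
      ρ x ≤ C * min (‖x‖ ^ (-γ₀)) (‖x‖ ^ (-γ)) := by
  have : Nonempty (Fin d) := ⟨⟨0, hd⟩⟩
  filter_upwards [hρ.inner, hρ.outer, Measure.ae_ne volume (0 : Rd d)] with x hin hout hx0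
  have hx := norm_pos_iff.2 hx0
  rcases lt_or_ge ‖x‖ 1 with h | h
  · rw [min_eq_left (Real.rpow_le_rpow_of_exponent_ge hx h.le (neg_le_neg h01))]
    exact hin h
  · rw [min_eq_right (Real.rpow_le_rpow_of_exponent_le h (neg_le_neg h01))]
    exact hout h

theorem ae_lower (hρ : IsWeight ρ γ₀ γ c C) (hd : 0 < d) (h0 : 0 ≤ γ₀) (h01 : γ₀ ≤ γ) :
    ∀ᵐ x, c * (1 + ‖x‖) ^ (-γ) ≤ ρ x := by
  have : Nonempty (Fin d) := ⟨⟨0, hd⟩⟩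
  filter_upwards [hρ.ae_bounds hd h01, Measure.ae_ne volume (0 : Rd d)] with x hbounds hx0
  have hx := norm_pos_iff.2 hx0
  have hmono (a : ℝ) (ha : 0 ≤ a) : (1 + ‖x‖) ^ (-a) ≤ ‖x‖ ^ (-a) :=
    Real.rpow_le_rpow_of_nonpos hx (by linarith) (neg_nonpos.2 ha)
  refine (mul_le_mul_of_nonneg_left (le_min ?_ (hmono γ (h0.trans h01))) hρ.c_pos.le).trans
    hbounds.1
  exact (Real.rpow_le_rpow_of_exponent_le (by linarith) (neg_le_neg h01)).trans (hmono γ₀ h0)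

theorem exists_lintegral_normed_mul_min_le (hd : 0 < d) (h0 : 0 ≤ γ₀) (h01 : γ₀ ≤ γ) (h1 : γ < d) :
    ∃ A : ENNReal, A ≠ ⊤ ∧ ∀ b : ContDiffBump (0 : Rd d), b.rOut = 2 * b.rIn → ∀ᵐ y : Rd d,
      ∫⁻ x, ENNReal.ofReal (b.normed volume (x - y)) *
          ENNReal.ofReal (min (‖x‖ ^ (-γ₀)) (‖x‖ ^ (-γ))) ≤
        A * ENNReal.ofReal (min (‖y‖ ^ (-γ₀)) (‖y‖ ^ (-γ))) := by
  have : Nonempty (Fin d) := ⟨⟨0, hd⟩⟩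
  have hfr : (Module.finrank ℝ (Rd d) : ℝ) = d := by rw [finrank_euclideanSpace_fin]
  obtain ⟨A₀, hA₀, havg₀⟩ := exists_lintegral_normed_mul_norm_rpow_neg_le (E := Rd d)
    (μ := volume) h0 (hfr ▸ h01.trans_lt h1)
  obtain ⟨A, hA, havg⟩ := exists_lintegral_normed_mul_norm_rpow_neg_le (E := Rd d)
    (μ := volume) (h0.trans h01) (hfr ▸ h1)
  refine ⟨max A₀ A, max_ne_top hA₀ hA, fun b hb => ?_⟩
  filter_upwards [Measure.ae_ne volume (0 : Rd d)] with y hy0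
  rw [ENNReal.ofReal_min, mul_min]
  refine le_min (le_trans ?_ ((havg₀ b hb y hy0).trans ?_))
    (le_trans ?_ ((havg b hb y hy0).trans ?_))
  · gcongr
    exact min_le_left _ _
  · gcongr
    exact le_max_left _ _
  · gcongr
    exact min_le_right _ _
  · gcongr
    exact le_max_right _ _

theorem isA1Weight (hρ : IsWeight ρ γ₀ γ c C) (hd : 0 < d) (h0 : 0 ≤ γ₀) (h01 : γ₀ ≤ γ)
    (h1 : γ < d) : IsA1Weight ρ γ := by
  refine ⟨hρ.aemeasurable, ⟨c, hρ.c_pos, hρ.ae_lower hd h0 h01⟩, ?_⟩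
  obtain ⟨A, hA, havg⟩ := exists_lintegral_normed_mul_min_le hd h0 h01 h1
  have hc := hρ.c_pos
  have hC := hc.trans hρ.c_lt_C
  refine ⟨ENNReal.ofReal (C / c) * A, ENNReal.mul_ne_top ENNReal.ofReal_ne_top hA, fun b hb => ?_⟩
  filter_upwards [havg b hb, hρ.ae_bounds hd h01] with y hy hbounds
  calc ∫⁻ x, ENNReal.ofReal (b.normed volume (x - y)) * ENNReal.ofReal (ρ x)
      ≤ ∫⁻ x, ENNReal.ofReal C * (ENNReal.ofReal (b.normed volume (x - y)) *
          ENNReal.ofReal (min (‖x‖ ^ (-γ₀)) (‖x‖ ^ (-γ)))) := by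
        refine lintegral_mono_ae ?_
        filter_upwards [hρ.ae_bounds hd h01] with x hx
        rw [mul_left_comm, ← ENNReal.ofReal_mul hC.le]
        gcongr
        exact hx.2
    _ ≤ ENNReal.ofReal C * (A * ENNReal.ofReal (min (‖y‖ ^ (-γ₀)) (‖y‖ ^ (-γ)))) := by
        rw [lintegral_const_mul' _ _ ENNReal.ofReal_ne_top]
        gcongr
    _ ≤ ENNReal.ofReal C * (A * ENNReal.ofReal (c⁻¹ * ρ y)) := by
        gcongr
        rw [inv_mul_eq_div, le_div_iff₀' hc]
        exact hbounds.1
    _ = ENNReal.ofReal (C / c) * A * ENNReal.ofReal (ρ y) := by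
        rw [ENNReal.ofReal_mul (by positivity), div_eq_mul_inv, ENNReal.ofReal_mul hC.le]
        ring

end IsWeight

/-! ### Cutoff and commutator -/

section SchurTest

variable {α : Type*} [MeasurableSpace α] {μ : Measure α} [SFinite μ] {u B : α → ℝ}
  {h : α × α → ℝ}

theorem integrable_prod_sq_mul (hu : AEStronglyMeasurable u μ)
    (hh : AEStronglyMeasurable h (μ.prod μ)) (h0 : ∀ z, 0 ≤ h z)
    (hint : ∀ x, Integrable (fun y => h (x, y)) μ) (hB : ∀ x, ∫ y, h (x, y) ∂μ ≤ B x)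
    (huB : Integrable (fun x => u x ^ 2 * B x) μ) :
    Integrable (fun z => u z.1 ^ 2 * h z) (μ.prod μ) :=
  integrable_prod_mul_of_integral_abs_le (hu.pow 2) hh hint
    (fun x => by simpa only [abs_of_nonneg (h0 _)] using hB x) huB

theorem abs_mul_mul_le_half_sq_mul_add {a b c : ℝ} (hc : 0 ≤ c) :
    |a * b * c| ≤ (a ^ 2 * c + b ^ 2 * c) / 2 := by
  rw [abs_mul, abs_of_nonneg hc, ← add_mul, mul_div_right_comm, abs_mul, ← sq_abs a, ← sq_abs b]
  gcongr
  linarith [two_mul_le_add_sq |a| |b|]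

theorem integrable_prod_mul_mul_of_symm (hu : AEStronglyMeasurable u μ)
    (hh : AEStronglyMeasurable h (μ.prod μ)) (h0 : ∀ z, 0 ≤ h z) (hsymm : ∀ z, h z.swap = h z)
    (hint : Integrable (fun z => u z.1 ^ 2 * h z) (μ.prod μ)) :
    Integrable (fun z => u z.1 * u z.2 * h z) (μ.prod μ) := by
  have hint' : Integrable (fun z => u z.2 ^ 2 * h z) (μ.prod μ) := by
    simpa only [Function.comp_def, Prod.fst_swap, hsymm] using hint.swap
  exact ((hint.add hint').div_const 2).mono' ((hu.comp_fst.mul hu.comp_snd).mul hh)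
    (.of_forall fun z => abs_mul_mul_le_half_sq_mul_add (h0 z))

theorem abs_integral_prod_mul_mul_le_of_symm (h0 : ∀ z, 0 ≤ h z) (hsymm : ∀ z, h z.swap = h z)
    (hB : ∀ x, ∫ y, h (x, y) ∂μ ≤ B x) (huB : Integrable (fun x => u x ^ 2 * B x) μ)
    (hint : Integrable (fun z => u z.1 ^ 2 * h z) (μ.prod μ)) :
    |∫ z, u z.1 * u z.2 * h z ∂(μ.prod μ)| ≤ ∫ x, u x ^ 2 * B x ∂μ := by
  have hint' : Integrable (fun z => u z.2 ^ 2 * h z) (μ.prod μ) := by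
    simpa only [Function.comp_def, Prod.fst_swap, hsymm] using hint.swap
  have hswap : ∫ z, u z.2 ^ 2 * h z ∂(μ.prod μ) = ∫ z, u z.1 ^ 2 * h z ∂(μ.prod μ) := by
    rw [← integral_prod_swap]
    simp only [Prod.snd_swap, hsymm]
  calc |∫ z, u z.1 * u z.2 * h z ∂(μ.prod μ)|
      ≤ ∫ z, (u z.1 ^ 2 * h z + u z.2 ^ 2 * h z) / 2 ∂(μ.prod μ) := by
        rw [← Real.norm_eq_abs]
        exact norm_integral_le_of_norm_le ((hint.add hint').div_const 2)
          (.of_forall fun z => abs_mul_mul_le_half_sq_mul_add (h0 z))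
    _ = ∫ z, u z.1 ^ 2 * h z ∂(μ.prod μ) := by
        rw [integral_div, integral_add hint hint', hswap, add_self_div_two]
    _ = ∫ x, u x ^ 2 * ∫ y, h (x, y) ∂μ ∂μ := by
        rw [integral_prod _ hint]
        simp only [integral_const_mul]
    _ ≤ ∫ x, u x ^ 2 * B x ∂μ := by
        refine integral_mono_of_nonneg (.of_forall fun x =>
          mul_nonneg (sq_nonneg _) (integral_nonneg fun y => h0 _)) huB (.of_forall fun x => ?_)
        exact mul_le_mul_of_nonneg_left (hB x) (sq_nonneg _)

end SchurTest

theorem diffQuot_swap_sq (s : ℝ) (v : Rd d → ℝ) (z : Rd d × Rd d) :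
    diffQuot s v z.swap ^ 2 = diffQuot s v z ^ 2 := by
  rw [diffQuot_sq, diffQuot_sq, Prod.fst_swap, Prod.snd_swap, norm_sub_rev, sub_sq_comm]

theorem gagliardoIntegrand_mul_mul (s : ℝ) (ψ u : Rd d → ℝ) (z : Rd d × Rd d) :
    gagliardoIntegrand s u (fun x => ψ x * (ψ x * u x)) z.1 z.2 =
      diffQuot s (fun x => ψ x * u x) z ^ 2 - u z.1 * u z.2 * diffQuot s ψ z ^ 2 := by
  simp only [diffQuot_sq, gagliardoIntegrand]
  ring

namespace IsTest

variable {ψ u B : Rd d → ℝ}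

theorem mul_contDiff (hψ : IsTest ψ) (hu : ContDiff ℝ ∞ u) : IsTest fun x => ψ x * u x :=
  ⟨hψ.1.mul hu, hψ.2.mul_right⟩

theorem integrable_diffQuot_sq (hψ : IsTest ψ) (hs0 : 0 < s) (hs1 : s < 1) (x : Rd d) :
    Integrable fun y => diffQuot s ψ (x, y) ^ 2 := by
  have hc := hψ.continuous
  obtain ⟨M, -, hM⟩ := hψ.exists_sq_diff_le
  rw [← (measurePreserving_add_left volume x).integrable_comp_emb
    (MeasurableEquiv.addLeft x).measurableEmbedding]
  simp only [Function.comp_def, diffQuot_add_sq]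
  exact integrable_div_norm_rpow (finrank_Rd_lt hs0) (lt_finrank_Rd_add_two hs1)
    (Continuous.aestronglyMeasurable (by fun_prop)) fun z => by rw [abs_sq]; exact hM x z

/-- The difference is the commutator `C_{d,s} / 2 ∬ u(x) u(y) (ψ(x) - ψ(y))² / |x - y|^(d + 2s)`,
to which the Schur test applies. -/
theorem abs_energy_sub_integral_mul_fracLap_le (hψ : IsTest ψ) (hs0 : 0 < s) (hs1 : s < 1)
    (hu : ContDiff ℝ ∞ u) (hud : MemL1Decay (d + 2 * s) u)
    (hB : ∀ x, ∫ y, diffQuot s ψ (x, y) ^ 2 ≤ B x) (huB : Integrable fun x => u x ^ 2 * B x) :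
    |fracConst d s / 2 * ∫ z, diffQuot s (fun x => ψ x * u x) z ^ 2 ∂(volume.prod volume) -
        ∫ x, u x * fracLap s (fun x => ψ x * (ψ x * u x)) x| ≤
      fracConst d s / 2 * ∫ x, u x ^ 2 * B x := by
  have hC := fracConst_pos (d := d) hs0 hs1
  have hψu := hψ.mul_contDiff hu
  have hum : AEStronglyMeasurable u := hu.continuous.aestronglyMeasurable
  have hhm : AEStronglyMeasurable (fun z => diffQuot s ψ z ^ 2) (volume.prod volume) :=
    (aestronglyMeasurable_diffQuot s hψ.continuous.aestronglyMeasurable).pow 2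
  have hsq := integrable_prod_sq_mul hum hhm (fun z => sq_nonneg _)
    (hψ.integrable_diffQuot_sq hs0 hs1) hB huB
  have hcomm := integrable_prod_mul_mul_of_symm hum hhm (fun z => sq_nonneg _)
    (diffQuot_swap_sq s ψ) hsq
  have hcomm_le := abs_integral_prod_mul_mul_le_of_symm (fun z => sq_nonneg _)
    (diffQuot_swap_sq s ψ) hB huB hsq
  have henergy := (hψu.memLp_diffQuot hs0 hs1).integrable_sq
  rw [(hψ.mul_contDiff hψu.1).integral_mul_fracLap hs0 hs1 hud
    (by simpa only [gagliardoIntegrand_mul_mul] using! henergy.sub hcomm)]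
  simp only [gagliardoIntegrand_mul_mul]
  rw [integral_sub henergy hcomm, ← mul_sub, sub_sub_cancel, abs_mul, abs_of_pos (by positivity)]
  gcongr

end IsTest

/-- The profile of the cutoffs. -/
def unitBump (d : ℕ) : ContDiffBump (0 : Rd d) := ⟨1, 2, one_pos, one_lt_two⟩

/-- The smooth cutoff at scale `R`, equal to `1` for `|x| ≤ R` and to `0` for `|x| ≥ 2 R`. -/
def cutoff (R : ℝ) (x : Rd d) : ℝ := unitBump d (R⁻¹ • x)

theorem isTest_unitBump : IsTest (unitBump d : Rd d → ℝ) :=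
  ⟨(unitBump d).contDiff, (unitBump d).hasCompactSupport⟩

theorem isTest_cutoff {R : ℝ} (hR : 0 < R) : IsTest (cutoff R : Rd d → ℝ) :=
  ⟨isTest_unitBump.1.comp (contDiff_const_smul _),
    isTest_unitBump.2.comp_homeomorph (Homeomorph.smulOfNeZero R⁻¹ (inv_ne_zero hR.ne'))⟩

theorem cutoff_nonneg (R : ℝ) (x : Rd d) : 0 ≤ cutoff R x := (unitBump d).nonneg

theorem cutoff_le_one (R : ℝ) (x : Rd d) : cutoff R x ≤ 1 := (unitBump d).le_one

theorem cutoff_eq_one {R : ℝ} (hR : 0 < R) {x : Rd d} (hx : ‖x‖ ≤ R) : cutoff R x = 1 := by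
  refine (unitBump d).one_of_mem_closedBall ?_
  rw [mem_closedBall_zero_iff, norm_smul, norm_inv, Real.norm_of_nonneg hR.le,
    inv_mul_le_iff₀ hR]
  simpa [unitBump] using hx

theorem continuous_cutoff (R : ℝ) : Continuous (cutoff R : Rd d → ℝ) :=
  (unitBump d).continuous.comp (continuous_const_smul _)

theorem integral_diffQuot_sq_comp_smul {R : ℝ} (hR : 0 < R) (φ : Rd d → ℝ) (x : Rd d) :
    ∫ y, diffQuot s (fun x => φ (R⁻¹ • x)) (x, y) ^ 2 =
      R ^ (-(2 * s)) * ∫ y, diffQuot s φ (R⁻¹ • x, y) ^ 2 := by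
  have hscale (y : Rd d) : diffQuot s (fun x => φ (R⁻¹ • x)) (x, y) ^ 2 =
      R ^ (-((d : ℝ) + 2 * s)) * diffQuot s φ (R⁻¹ • x, R⁻¹ • y) ^ 2 := by
    have : R ^ ((d : ℝ) + 2 * s) ≠ 0 := (Real.rpow_pos_of_pos hR _).ne'
    rw [diffQuot_sq, diffQuot_sq, ← smul_sub, norm_smul, norm_inv, Real.norm_of_nonneg hR.le,
      Real.mul_rpow (by positivity) (norm_nonneg _), Real.inv_rpow hR.le, Real.rpow_neg hR.le,
      mul_div_assoc', mul_div_mul_left _ _ (inv_ne_zero this)]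
  simp only [hscale]
  rw [integral_const_mul,
    Measure.integral_comp_smul volume (fun y => diffQuot s φ (R⁻¹ • x, y) ^ 2) R⁻¹,
    finrank_euclideanSpace_fin, smul_eq_mul, inv_pow, inv_inv, abs_of_pos (by positivity),
    ← mul_assoc, ← Real.rpow_natCast, ← Real.rpow_add hR]
  congr 2
  ring

theorem exists_integral_diffQuot_cutoff_sq_le (hs0 : 0 < s) (hs1 : s < 1) :
    ∃ A, ∀ R : ℝ, 1 ≤ R → ∀ x : Rd d,
      ∫ y, diffQuot s (cutoff R) (x, y) ^ 2 ≤ A * (R + ‖x‖) ^ (-(2 * s)) := by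
  obtain ⟨A, hA⟩ := (isTest_unitBump (d := d)).exists_integral_sq_diff_le hs0 hs1
  refine ⟨|A|, fun R hR x => ?_⟩
  have hR0 : 0 < R := one_pos.trans_le hR
  have hnorm : R * (1 + ‖R⁻¹ • x‖) = R + ‖x‖ := by
    rw [norm_smul, norm_inv, Real.norm_of_nonneg hR0.le]
    field_simp
  calc ∫ y, diffQuot s (cutoff R) (x, y) ^ 2
      = R ^ (-(2 * s)) * ∫ z, diffQuot s (unitBump d) (R⁻¹ • x, R⁻¹ • x + z) ^ 2 := by
        rw [integral_add_left_eq_self (fun y => diffQuot s (unitBump d) (R⁻¹ • x, y) ^ 2)]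
        exact integral_diffQuot_sq_comp_smul hR0 (unitBump d) x
    _ ≤ R ^ (-(2 * s)) * (A * (1 + ‖R⁻¹ • x‖) ^ (-((d : ℝ) + 2 * s))) := by
        simp only [diffQuot_add_sq]
        gcongr
        exact hA _
    _ ≤ R ^ (-(2 * s)) * (|A| * (1 + ‖R⁻¹ • x‖) ^ (-(2 * s))) := by
        gcongr
        · exact le_abs_self A
        · exact le_add_of_nonneg_right (norm_nonneg _)
        · exact le_add_of_nonneg_left d.cast_nonneg
    _ = |A| * (R + ‖x‖) ^ (-(2 * s)) := by
        rw [mul_left_comm, ← Real.mul_rpow hR0.le (by positivity), hnorm]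

theorem norm_sq_mul_rpow_neg_le {σ R : ℝ} (hσ : 0 ≤ σ) (hR : 1 ≤ R) (u : Rd d → ℝ) (x : Rd d) :
    ‖u x ^ 2 * (R + ‖x‖) ^ (-σ)‖ ≤ u x ^ 2 * (1 + ‖x‖) ^ (-σ) := by
  rw [Real.norm_of_nonneg (by positivity)]
  gcongr u x ^ 2 * ?_
  exact Real.rpow_le_rpow_of_nonpos (by positivity) (by gcongr) (neg_nonpos.2 hσ)

theorem integrable_sq_mul_add_norm_rpow_neg {σ R : ℝ} (hσ : 0 ≤ σ) (hR : 1 ≤ R) {u : Rd d → ℝ}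
    (hum : AEStronglyMeasurable u) (hu : Integrable fun x => u x ^ 2 * (1 + ‖x‖) ^ (-σ)) :
    Integrable fun x => u x ^ 2 * (R + ‖x‖) ^ (-σ) :=
  hu.mono' ((hum.pow 2).mul (Measurable.aestronglyMeasurable (by fun_prop)))
    (.of_forall (norm_sq_mul_rpow_neg_le hσ hR u))

theorem tendsto_integral_sq_mul_add_norm_rpow_neg {σ : ℝ} (hσ : 0 < σ) {u : Rd d → ℝ}
    (hum : AEStronglyMeasurable u) (hu : Integrable fun x => u x ^ 2 * (1 + ‖x‖) ^ (-σ)) :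
    Tendsto (fun R : ℝ => ∫ x, u x ^ 2 * (R + ‖x‖) ^ (-σ)) atTop (𝓝 0) := by
  have hlim (x : Rd d) : Tendsto (fun R : ℝ => u x ^ 2 * (R + ‖x‖) ^ (-σ)) atTop (𝓝 0) := by
    simpa using ((tendsto_rpow_neg_atTop hσ).comp
      (tendsto_atTop_add_const_right _ ‖x‖ tendsto_id)).const_mul (u x ^ 2)
  rw [← integral_zero (Rd d) ℝ]
  refine tendsto_integral_filter_of_dominated_convergence _
    (.of_forall fun R => (hum.pow 2).mul (Measurable.aestronglyMeasurable (by fun_prop)))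
    ?_ hu (.of_forall hlim)
  filter_upwards [eventually_ge_atTop 1] with R hR
  exact .of_forall (norm_sq_mul_rpow_neg_le hσ.le hR u)

theorem exists_seq_tendsto_integral_sq_mul_add_norm_rpow_neg {σ : ℝ} (hσ : 0 < σ)
    {u : ℕ → Rd d → ℝ} (hum : ∀ n, AEStronglyMeasurable (u n))
    (hu : ∀ n, Integrable fun x => u n x ^ 2 * (1 + ‖x‖) ^ (-σ)) :
    ∃ R : ℕ → ℝ, (∀ n, 1 ≤ R n) ∧ Tendsto R atTop atTop ∧
      Tendsto (fun n => ∫ x, u n x ^ 2 * (R n + ‖x‖) ^ (-σ)) atTop (𝓝 0) := by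
  have hsmall (n : ℕ) : ∃ R : ℝ, 1 ≤ R ∧ (n : ℝ) ≤ R ∧
      ∫ x, u n x ^ 2 * (R + ‖x‖) ^ (-σ) < 1 / ((n : ℝ) + 1) :=
    ((eventually_ge_atTop 1).and ((eventually_ge_atTop (n : ℝ)).and
      ((tendsto_integral_sq_mul_add_norm_rpow_neg hσ (hum n) (hu n)).eventually_lt_const
        (by positivity)))).exists
  choose R hR1 hRn hR using hsmall
  refine ⟨R, hR1, tendsto_atTop_mono hRn tendsto_natCast_atTop_atTop,
    squeeze_zero (fun n => integral_nonneg fun x => ?_) (fun n => (hR n).le)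
      tendsto_one_div_add_atTop_nhds_zero_nat⟩
  have : 0 ≤ R n := zero_le_one.trans (hR1 n)
  positivity

theorem tendsto_eLpNorm_cutoff_mul_sub {ν : Measure (Rd d)} {p : ℝ} (hp : 1 ≤ p)
    (hv : MemLp v (ENNReal.ofReal p) ν) {R : ℕ → ℝ} (hR : Tendsto R atTop atTop)
    {U : ℕ → Rd d → ℝ} (hU : ∀ n, AEStronglyMeasurable (U n) ν)
    (hlim : Tendsto (fun n => eLpNorm (U n - v) (ENNReal.ofReal p) ν) atTop (𝓝 0)) :
    Tendsto (fun n => eLpNorm (cutoff (R n) * U n - v) (ENNReal.ofReal p) ν) atTop (𝓝 0) := by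
  have hcm (n : ℕ) : AEStronglyMeasurable (cutoff (R n) : Rd d → ℝ) ν :=
    (continuous_cutoff (R n)).aestronglyMeasurable
  have hcut : Tendsto (fun n => eLpNorm (cutoff (R n) * v - v) (ENNReal.ofReal p) ν) atTop
      (𝓝 0) := by
    refine tendsto_eLpNorm_sub_of_dominated (one_pos.trans_le hp) hv.norm
      (fun n => (hcm n).mul hv.1) hv.1
      (.of_forall fun n => .of_forall fun x => ?_) (.of_forall fun x => ?_)
    · rw [Pi.mul_apply, ← sub_one_mul, abs_mul, abs_sub_comm,
        abs_of_nonneg (sub_nonneg.2 (cutoff_le_one (R n) x))]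
      exact mul_le_of_le_one_left (abs_nonneg _) (sub_le_self _ (cutoff_nonneg (R n) x))
    · refine tendsto_const_nhds.congr' ?_
      filter_upwards [hR.eventually_ge_atTop ‖x‖, hR.eventually_gt_atTop 0] with n hn hn0
      rw [Pi.mul_apply, cutoff_eq_one hn0 hn, one_mul]
  refine tendsto_of_tendsto_of_tendsto_of_le_of_le tendsto_const_nhds
    (by simpa only [add_zero] using hlim.add hcut) (fun n => zero_le) fun n => ?_
  calc eLpNorm (cutoff (R n) * U n - v) (ENNReal.ofReal p) ν
      = eLpNorm (cutoff (R n) * (U n - v) + (cutoff (R n) * v - v)) (ENNReal.ofReal p) ν := by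
        rw [mul_sub, sub_add_sub_cancel]
    _ ≤ eLpNorm (cutoff (R n) * (U n - v)) (ENNReal.ofReal p) ν +
          eLpNorm (cutoff (R n) * v - v) (ENNReal.ofReal p) ν :=
        eLpNorm_add_le ((hcm n).mul ((hU n).sub hv.1)) (((hcm n).mul hv.1).sub hv.1)
          (by simpa using hp)
    _ ≤ _ := by
        gcongr ?_ + _
        refine eLpNorm_mono fun x => ?_
        rw [Pi.mul_apply, norm_mul, Real.norm_of_nonneg (cutoff_nonneg _ _)]
        exact mul_le_of_le_one_left (norm_nonneg _) (cutoff_le_one _ _)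

/-! ### Finite energy and strong approximation -/

section SquareIntegrable

variable {α : Type*} [MeasurableSpace α] {ν : Measure α} {f : α → ℝ} {g : ℕ → α → ℝ} {a : ℝ}

theorem eLpNorm_two_eq_ofReal_integral_sq (hf : MemLp f 2 ν) :
    eLpNorm f 2 ν = ENNReal.ofReal (∫ x, f x ^ 2 ∂ν) ^ (1 / 2 : ℝ) := by
  rw [hf.eLpNorm_eq_integral_rpow_norm two_ne_zero ENNReal.ofNat_ne_top,
    ENNReal.ofReal_rpow_of_nonneg (integral_nonneg fun x => sq_nonneg _) (by norm_num)]
  simp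

theorem memLp_two_and_integral_sq_le_of_tendsto_ae (hg : ∀ n, MemLp (g n) 2 ν)
    (hlim : ∀ᵐ x ∂ν, Tendsto (fun n => g n x) atTop (𝓝 (f x)))
    (ha : Tendsto (fun n => ∫ x, g n x ^ 2 ∂ν) atTop (𝓝 a)) :
    MemLp f 2 ν ∧ ∫ x, f x ^ 2 ∂ν ≤ a := by
  have ha0 : 0 ≤ a := ge_of_tendsto' ha fun n => integral_nonneg fun x => sq_nonneg _
  have hnorm : Tendsto (fun n => eLpNorm (g n) 2 ν) atTop
      (𝓝 (ENNReal.ofReal a ^ (1 / 2 : ℝ))) := by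
    simp only [eLpNorm_two_eq_ofReal_integral_sq (hg _)]
    exact (ENNReal.continuous_rpow_const.tendsto _).comp (ENNReal.tendsto_ofReal ha)
  have hle := Lp.eLpNorm_lim_le_liminf_eLpNorm (p := 2) (fun n => (hg n).1) f hlim
  rw [hnorm.liminf_eq] at hle
  have hf : MemLp f 2 ν := ⟨aestronglyMeasurable_of_tendsto_ae _ (fun n => (hg n).1) hlim,
    hle.trans_lt (ENNReal.rpow_lt_top_of_nonneg (by norm_num) ENNReal.ofReal_ne_top)⟩
  refine ⟨hf, ?_⟩
  rwa [eLpNorm_two_eq_ofReal_integral_sq hf, ENNReal.rpow_le_rpow_iff (by norm_num),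
    ENNReal.ofReal_le_ofReal_iff ha0] at hle

theorem tendsto_eLpNorm_two_sub_of_tendsto_integral (hf : MemLp f 2 ν)
    (hg : ∀ n, MemLp (g n) 2 ν) (hfa : ∫ x, f x ^ 2 ∂ν ≤ a)
    (hfg : Tendsto (fun n => ∫ x, f x * g n x ∂ν) atTop (𝓝 a))
    (hgg : Tendsto (fun n => ∫ x, g n x ^ 2 ∂ν) atTop (𝓝 a)) :
    Tendsto (fun n => eLpNorm (g n - f) 2 ν) atTop (𝓝 0) := by
  have hexpand (n : ℕ) : ∫ x, (g n - f) x ^ 2 ∂ν =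
      ∫ x, g n x ^ 2 ∂ν - 2 * ∫ x, f x * g n x ∂ν + ∫ x, f x ^ 2 ∂ν := by
    have hcross : Integrable (fun x => 2 * (f x * g n x)) ν :=
      (hf.integrable_mul (hg n)).const_mul 2
    rw [← integral_const_mul, ← integral_sub (hg n).integrable_sq hcross,
      ← integral_add (by exact (hg n).integrable_sq.sub hcross) hf.integrable_sq]
    congr with x
    simp only [Pi.sub_apply]
    ring
  have hlim : Tendsto (fun n => ∫ x, g n x ^ 2 ∂ν - 2 * ∫ x, f x * g n x ∂ν + a) atTop (𝓝 0) := by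
    convert (hgg.sub (hfg.const_mul 2)).add_const a using 2
    ring
  have hsq : Tendsto (fun n => ∫ x, (g n - f) x ^ 2 ∂ν) atTop (𝓝 0) :=
    squeeze_zero (fun n => integral_nonneg fun x => sq_nonneg _)
      (fun n => by rw [hexpand]; gcongr) hlim
  simp only [eLpNorm_two_eq_ofReal_integral_sq ((hg _).sub hf)]
  simpa using! (ENNReal.continuous_rpow_const (y := 1 / 2)).tendsto _ |>.comp
    (ENNReal.tendsto_ofReal hsq)

end SquareIntegrable

/-- The bump functions used for mollification, of radius `2 / (n + 1)`. -/
def smallBump (d n : ℕ) : ContDiffBump (0 : Rd d) :=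
  ⟨1 / ((n : ℝ) + 1), 2 * (1 / ((n : ℝ) + 1)), by positivity,
    lt_mul_left (by positivity) one_lt_two⟩

theorem tendsto_rOut_smallBump : Tendsto (fun n => (smallBump d n).rOut) atTop (𝓝 0) := by
  simpa only [mul_zero] using!
    (tendsto_one_div_add_atTop_nhds_zero_nat (𝕜 := ℝ)).const_mul 2

/-- `v` lies in the domain of `A = ρ⁻¹ (-Δ)^s` as an operator from `L^p_ρ` to its dual `L^{p'}_ρ`,
and `f = (-Δ)^s v`. -/
structure MemDomain (s p : ℝ) (ρ v f : Rd d → ℝ) : Prop where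
  memLp : MemLpWeight p ρ v
  isDistribFracLap : IsDistribFracLap s v f
  memLp_inv_mul : MemLpWeight (p / (p - 1)) ρ fun x => (ρ x)⁻¹ * f x

namespace MemDomain

variable {p γ : ℝ} {ρ f g u : Rd d → ℝ} {φ : ℕ → Rd d → ℝ}

theorem integrable_mul (hw : MemDomain s p ρ w g) (hρ : IsA1Weight ρ γ) (hp : 1 < p)
    (hu : MemLpWeight p ρ u) : Integrable fun x => g x * u x :=
  hρ.integrable_mul (.conjExponent hp) hw.memLp_inv_mul hu

theorem tendsto_integral_mul (hw : MemDomain s p ρ w g) (hρ : IsA1Weight ρ γ) (hp : 1 < p)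
    (hu : MemLpWeight p ρ u) (hφ : ∀ n, IsTest (φ n))
    (hlim : Tendsto (fun n => eLpNorm (φ n - u) (ENNReal.ofReal p) (weightMeasure ρ))
      atTop (𝓝 0)) :
    Tendsto (fun n => ∫ x, g x * φ n x) atTop (𝓝 (∫ x, g x * u x)) :=
  hρ.tendsto_integral_mul (.conjExponent hp) hw.memLp_inv_mul hu
    (fun n => hρ.memLpWeight_of_continuous p (hφ n).continuous (hφ n).2) hlim

variable (hv : MemDomain s p ρ v f) (hw : MemDomain s p ρ w g) (hρ : IsA1Weight ρ γ)
  (hs0 : 0 < s) (hs1 : s < 1) (hp : 2 ≤ p) (hps : p * (d - 2 * s) < 2 * (d - γ))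

include hv hρ hs0 hp hps in
theorem memL1Decay : MemL1Decay (d + 2 * s) v :=
  .of_integrable_sq (by positivity) (hρ.aestronglyMeasurable hv.memLp)
    (hρ.integrable_sq_mul_rpow_neg hp hps hv.memLp)

include hv hρ hs0 hs1 hp hps

theorem tendsto_integral_mollify_mul_fracLap (hφ : ∀ n, IsTest (φ n))
    (hlim : Tendsto (fun n => eLpNorm (φ n - v) (ENNReal.ofReal p) (weightMeasure ρ))
      atTop (𝓝 0)) :
    Tendsto (fun n => ∫ x, mollify volume (smallBump d n) v x * fracLap s (φ n) x) atTop
      (𝓝 (∫ x, f x * v x)) := by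
  have hp1 : 1 < p := by linarith
  have hf := hρ.locallyIntegrable_of_inv_mul (.conjExponent hp1) hv.memLp_inv_mul
  simp only [hv.isDistribFracLap.integral_mollify_mul_fracLap hs0 hs1
    (hv.memL1Decay hρ hs0 hp hps) hf (hφ _)]
  exact hv.tendsto_integral_mul hρ hp1 hv.memLp (fun n => (hφ n).mollify _)
    (hρ.tendsto_eLpNorm_mollify_comp_sub hp1 hv.memLp
      (fun n => hρ.memLpWeight_of_continuous p (hφ n).continuous (hφ n).2) hlim (fun _ => rfl)
      tendsto_rOut_smallBump)

theorem exists_isTest_tendsto_energy : ∃ φ : ℕ → Rd d → ℝ, (∀ n, IsTest (φ n)) ∧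
    Tendsto (fun n => eLpNorm (φ n - v) (ENNReal.ofReal p) (weightMeasure ρ)) atTop (𝓝 0) ∧
    Tendsto (fun n => fracConst d s / 2 * ∫ z, diffQuot s (φ n) z ^ 2 ∂(volume.prod volume))
      atTop (𝓝 (∫ x, f x * v x)) := by
  have hp1 : 1 < p := by linarith
  let u (n : ℕ) : Rd d → ℝ := mollify volume (smallBump d n) v
  have hu (n : ℕ) : ContDiff ℝ ∞ (u n) :=
    contDiff_mollify _ (hρ.locallyIntegrable (.conjExponent hp1) hv.memLp)
  have hum (n : ℕ) : AEStronglyMeasurable (u n) := (hu n).continuous.aestronglyMeasurable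
  have hu2 (n : ℕ) : Integrable fun x => u n x ^ 2 * (1 + ‖x‖) ^ (-(2 * s)) :=
    hρ.integrable_sq_mul_rpow_neg hp hps (hρ.memLpWeight_mollify hp1 hv.memLp rfl)
  obtain ⟨R, hR1, hR, hRu⟩ :=
    exists_seq_tendsto_integral_sq_mul_add_norm_rpow_neg (σ := 2 * s) (by positivity) hum hu2
  obtain ⟨A, hA⟩ := exists_integral_diffQuot_cutoff_sq_le (d := d) hs0 hs1
  have hψ (n : ℕ) : IsTest (cutoff (R n) : Rd d → ℝ) := isTest_cutoff (one_pos.trans_le (hR1 n))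
  let φ (n : ℕ) : Rd d → ℝ := cutoff (R n) * u n
  have hφ (n : ℕ) : IsTest (φ n) := (hψ n).mul_contDiff (hu n)
  have hφv := tendsto_eLpNorm_cutoff_mul_sub hp1.le hv.memLp hR
    (fun n => (hu n).continuous.aestronglyMeasurable)
    (hρ.tendsto_eLpNorm_mollify_sub hp1 hv.memLp (fun _ => rfl) tendsto_rOut_smallBump)
  have hψφv := tendsto_eLpNorm_cutoff_mul_sub hp1.le hv.memLp hR
    (fun n => (hφ n).continuous.aestronglyMeasurable) hφv
  refine ⟨φ, hφ, hφv, ?_⟩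
  have hpairing := hv.tendsto_integral_mollify_mul_fracLap hρ hs0 hs1 hp hps
    (fun n => (hψ n).mul_contDiff (hφ n).1) hψφv
  have hcommutator (n : ℕ) :=
    (hψ n).abs_energy_sub_integral_mul_fracLap_le hs0 hs1 (hu n)
      (.of_integrable_sq (by positivity) (hum n) (hu2 n)) (hA (R n) (hR1 n)) <|
      ((integrable_sq_mul_add_norm_rpow_neg (by positivity) (hR1 n) (hum n) (hu2 n)).const_mul
        A).congr (.of_forall fun x => mul_left_comm _ _ _)
  simp only [mul_left_comm (u _ _ ^ 2) A, integral_const_mul] at hcommutator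
  have hsum := (squeeze_zero_norm hcommutator
    (by simpa using (hRu.const_mul A).const_mul (fracConst d s / 2))).add hpairing
  rw [zero_add] at hsum
  exact hsum.congr fun n => sub_add_cancel _ _

theorem exists_isTest_tendsto_ae : ∃ φ : ℕ → Rd d → ℝ, (∀ n, IsTest (φ n)) ∧
    Tendsto (fun n => eLpNorm (φ n - v) (ENNReal.ofReal p) (weightMeasure ρ)) atTop (𝓝 0) ∧
    (∀ᵐ x, Tendsto (fun n => φ n x) atTop (𝓝 (v x))) ∧
    Tendsto (fun n => ∫ z, diffQuot s (φ n) z ^ 2 ∂(volume.prod volume))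
      atTop (𝓝 (2 / fracConst d s * ∫ x, f x * v x)) := by
  have hC := fracConst_pos (d := d) hs0 hs1
  obtain ⟨φ, hφ, hφv, henergy⟩ := hv.exists_isTest_tendsto_energy hρ hs0 hs1 hp hps
  obtain ⟨k, hk, hae⟩ := (tendstoInMeasure_of_tendsto_eLpNorm
    (by simpa using (by linarith : 0 < p))
    (fun n => (hφ n).continuous.aestronglyMeasurable) hv.memLp.1 hφv).exists_seq_tendsto_ae
  refine ⟨fun n => φ (k n), fun n => hφ _, hφv.comp hk.tendsto_atTop,
    hρ.absolutelyContinuous.ae_le hae,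
    ((henergy.comp hk.tendsto_atTop).const_mul (2 / fracConst d s)).congr fun n => ?_⟩
  simp only [Function.comp_apply]
  field_simp

omit hv in
include hw in
theorem tendsto_integral_diffQuot_mul (hwE : MemLp (diffQuot s w) 2 (volume.prod volume))
    (hu : MemLpWeight p ρ u) (hφ : ∀ n, IsTest (φ n))
    (hlim : Tendsto (fun n => eLpNorm (φ n - u) (ENNReal.ofReal p) (weightMeasure ρ))
      atTop (𝓝 0)) :
    Tendsto (fun n => ∫ z, diffQuot s w z * diffQuot s (φ n) z ∂(volume.prod volume)) atTop
      (𝓝 (2 / fracConst d s * ∫ x, g x * u x)) := by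
  have hC := fracConst_pos (d := d) hs0 hs1
  refine ((hw.tendsto_integral_mul hρ (by linarith) hu hφ hlim).const_mul
    (2 / fracConst d s)).congr fun n => ?_
  rw [← hw.isDistribFracLap _ (hφ n), (hφ n).integral_mul_fracLap hs0 hs1
    (hw.memL1Decay hρ hs0 hp hps)
    (integrable_gagliardoIntegrand hwE ((hφ n).memLp_diffQuot hs0 hs1))]
  simp only [diffQuot_mul_diffQuot]
  field_simp

theorem memLp_diffQuot_and_exists_isTest_tendsto :
    MemLp (diffQuot s v) 2 (volume.prod volume) ∧
    ∃ φ : ℕ → Rd d → ℝ, (∀ n, IsTest (φ n)) ∧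
      Tendsto (fun n => eLpNorm (φ n - v) (ENNReal.ofReal p) (weightMeasure ρ)) atTop (𝓝 0) ∧
      Tendsto (fun n => eLpNorm (diffQuot s (φ n) - diffQuot s v) 2 (volume.prod volume))
        atTop (𝓝 0) := by
  obtain ⟨φ, hφ, hφv, hae, henergy⟩ := hv.exists_isTest_tendsto_ae hρ hs0 hs1 hp hps
  have hφE (n : ℕ) := (hφ n).memLp_diffQuot hs0 hs1
  have hae' : ∀ᵐ z : Rd d × Rd d ∂(volume.prod volume),
      Tendsto (fun n => diffQuot s (φ n) z) atTop (𝓝 (diffQuot s v z)) := by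
    filter_upwards [Measure.quasiMeasurePreserving_fst.ae hae,
      Measure.quasiMeasurePreserving_snd.ae hae] with z hz1 hz2
    exact (hz1.sub hz2).mul_const _
  obtain ⟨hvE, hle⟩ := memLp_two_and_integral_sq_le_of_tendsto_ae hφE hae' henergy
  have hcross := hv.tendsto_integral_diffQuot_mul hρ hs0 hs1 hp hps hvE hv.memLp hφ hφv
  exact ⟨hvE, φ, hφ, hφv, tendsto_eLpNorm_two_sub_of_tendsto_integral hvE hφE hle hcross henergy⟩

theorem memHdot : MemHdot s v := by
  obtain ⟨-, φ, hφ, hφv, hφE⟩ :=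
    hv.memLp_diffQuot_and_exists_isTest_tendsto hρ hs0 hs1 hp hps
  have hconj : p.HolderConjugate (p / (p - 1)) := .conjExponent (by linarith)
  refine ⟨hρ.locallyIntegrable hconj hv.memLp, φ, hφ, ?_, fun K hK =>
    hρ.tendsto_setLIntegral_enorm_sub hconj hv.memLp
      (fun n => hρ.memLpWeight_of_continuous p (hφ n).continuous (hφ n).2) hφv hK⟩
  have hnorm (n : ℕ) : hdotNormSq s (fun x => v x - φ n x) = ENNReal.ofReal (fracConst d s / 2) *
      eLpNorm (diffQuot s (φ n) - diffQuot s v) 2 (volume.prod volume) ^ 2 := by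
    rw [eLpNorm_sub_comm, ← diffQuot_sub]
    exact hdotNormSq_eq ((hρ.aestronglyMeasurable hv.memLp).sub
      (hφ n).continuous.aestronglyMeasurable)
  simp only [hnorm]
  simpa using ENNReal.Tendsto.const_mul (a := ENNReal.ofReal (fracConst d s / 2))
    ((ENNReal.continuous_pow 2).tendsto 0 |>.comp hφE) (.inr ENNReal.ofReal_ne_top)

include hw

theorem integral_mul_eq : ∫ x, g x * v x =
    fracConst d s / 2 * ∫ z, gagliardoIntegrand s w v z.1 z.2 ∂(volume.prod volume) := by
  have hC := fracConst_pos (d := d) hs0 hs1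
  obtain ⟨hvE, φ, hφ, hφv, hφE⟩ :=
    hv.memLp_diffQuot_and_exists_isTest_tendsto hρ hs0 hs1 hp hps
  have hwE := (hw.memLp_diffQuot_and_exists_isTest_tendsto hρ hs0 hs1 hp hps).1
  have hlimit := tendsto_nhds_unique
    (hw.tendsto_integral_diffQuot_mul hρ hs0 hs1 hp hps hwE hv.memLp hφ hφv)
    (tendsto_integral_mul_of_tendsto_eLpNorm hwE hvE
      (fun n => (hφ n).memLp_diffQuot hs0 hs1) hφE)
  simp only [← diffQuot_mul_diffQuot, ← hlimit]
  field_simp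

end MemDomain

end WeightedFracLap

end

open WeightedFracLap in
theorem propositionB1_general {d : ℕ} {s γ p : ℝ} (hs0 : 0 < s) (hs1 : s < 1)
    {ρ : Rd d → ℝ} (hρ : IsA1Weight ρ γ) (hp : 2 ≤ p) (hps : p * (d - 2 * s) < 2 * (d - γ))
    {v w Lv Lw : Rd d → ℝ} (hv : MemDomain s p ρ v Lv) (hw : MemDomain s p ρ w Lw) :
    MemHdot s v ∧ MemHdot s w ∧
    Integrable (fun x => v x * Lw x) volume ∧
    Integrable (fun x => Lv x * w x) volume ∧
    Integrable (fun z : Rd d × Rd d => gagliardoIntegrand s v w z.1 z.2) (volume.prod volume) ∧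
    ∫ x, v x * Lw x = ∫ x, Lv x * w x ∧
    ∫ x, Lv x * w x = fracConst d s / 2 * ∫ x, ∫ y, gagliardoIntegrand s v w x y := by
  have hp1 : 1 < p := by linarith
  have hform := integrable_gagliardoIntegrand
    (hv.memLp_diffQuot_and_exists_isTest_tendsto hρ hs0 hs1 hp hps).1
    (hw.memLp_diffQuot_and_exists_isTest_tendsto hρ hs0 hs1 hp hps).1
  have hvw := hw.integral_mul_eq hv hρ hs0 hs1 hp hps
  have hwv := hv.integral_mul_eq hw hρ hs0 hs1 hp hps
  simp only [gagliardoIntegrand_comm w v, mul_comm (Lw _)] at hwv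
  refine ⟨hv.memHdot hρ hs0 hs1 hp hps, hw.memHdot hρ hs0 hs1 hp hps,
    (hw.integrable_mul hρ hp1 hv.memLp).congr (.of_forall fun x => mul_comm _ _),
    hv.integrable_mul hρ hp1 hw.memLp, hform, hwv.trans hvw.symm, ?_⟩
  rw [hvw, integral_prod _ hform]

theorem propositionB1 (d : ℕ) (s γ₀ γ c C p : ℝ)
    (hs0 : 0 < s) (hs1 : s < 1) (hd : 2 * s < (d : ℝ))
    (hγ0 : 0 ≤ γ) (hγ1 : γ < 2 * s) (hγ2 : γ ≤ (d : ℝ) - 2 * s)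
    (hγ₀0 : 0 ≤ γ₀) (hγ₀1 : γ₀ ≤ γ)
    (ρ : WeightedFracLap.Rd d → ℝ) (hρ : WeightedFracLap.IsWeight ρ γ₀ γ c C)
    (hp0 : 2 ≤ p) (hp1 : p < 2 * ((d : ℝ) - γ) / ((d : ℝ) - 2 * s))
    (v w Lv Lw : WeightedFracLap.Rd d → ℝ)
    (hv : WeightedFracLap.MemLpWeight p ρ v) (hw : WeightedFracLap.MemLpWeight p ρ w)
    (hLv : WeightedFracLap.IsDistribFracLap s v Lv)
    (hLw : WeightedFracLap.IsDistribFracLap s w Lw)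
    (hAv : WeightedFracLap.MemLpWeight (p / (p - 1)) ρ (fun x => (ρ x)⁻¹ * Lv x))
    (hAw : WeightedFracLap.MemLpWeight (p / (p - 1)) ρ (fun x => (ρ x)⁻¹ * Lw x)) :
    WeightedFracLap.MemHdot s v ∧ WeightedFracLap.MemHdot s w ∧
    Integrable (fun x => v x * Lw x) volume ∧
    Integrable (fun x => Lv x * w x) volume ∧
    Integrable (fun z : WeightedFracLap.Rd d × WeightedFracLap.Rd d =>
      WeightedFracLap.gagliardoIntegrand s v w z.1 z.2) (volume.prod volume) ∧
    ∫ x, v x * Lw x = ∫ x, Lv x * w x ∧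
    ∫ x, Lv x * w x =
      WeightedFracLap.fracConst d s / 2 *
        ∫ x, ∫ y, WeightedFracLap.gagliardoIntegrand s v w x y := by
  have hd0 : 0 < d := by exact_mod_cast (by linarith : (0 : ℝ) < d)
  exact propositionB1_general hs0 hs1 (hρ.isA1Weight hd0 hγ₀0 hγ₀1 (by linarith)) hp0
    ((lt_div_iff₀ (by linarith)).1 hp1) ⟨hv, hLv, hAv⟩ ⟨hw, hLw, hAw⟩
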